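/- Let $\mathbb P$ be the set of prime numbers, and identify subsets of $\mathbb P$ with subsets of $\omega$ through $n\mapsto p_n$, the $n$-th prime ($p_0=2$). Give $2^{\mathbb P}$ (the space of all $W\subseteq\mathbb P$) the product topology of the discrete two-point space. For $W\subseteq\mathbb P$ let $R_W=\mathbb Z[\tfrac1p : p\in W]\subseteq\mathbb Q$. For a commutative ring $R$ let $\mathrm{HTP}(R)$ be the set of polynomials $f\in\mathbb Z[X_0,X_1,\dots]$ such that $f=0$ has a solution in $R$; it is viewed as a subset of $\omega$ by means of a fixed, but arbitrary, computable bijection from $\omega$ onto $\mathbb Z[X_0,X_1,\dots]$. Let $\chi_A$ be the characteristic function of $A\subseteq\omega$, and let $A\oplus B=\{2n:n\in A\}\cup\{2n+1:n\in B\}$. For each polynomial $f$ put $\mathcal A(f)=\{W\subseteq\mathbb P : f\in\mathrm{HTP}(R_W)\}$, let $\mathcal B(f)$ be the topological boundary of $\mathcal A(f)$ in $2^{\mathbb P}$, and call $W$ HTP-generic if $W\notin\bigcup_{f\in\mathbb Z[X_0,X_1,\dots]}\mathcal B(f)$. There is a single Turing functional (oracle program) $\Phi$ such that the set $$\{W\subseteq\mathbb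 P : \Phi^{W\oplus\mathrm{HTP}(\mathbb Q)}=\chi_{\mathrm{HTP}(R_W)}\}$$ is comeager in $2^{\mathbb P}$. Moreover, $\mathrm{HTP}(R_W)\equiv_T W\oplus\mathrm{HTP}(\mathbb Q)$ for every HTP-generic set $W$. -/

import Mathlib

/-- Programs for an oracle machine: the usual codes for partial recursive functions,
with one additional instruction `oracle` that queries the oracle. -/
inductive OracleCode : Type
  | zero : OracleCode
  | succ : OracleCode
  | left : OracleCode
  | right : OracleCode
  | oracle : OracleCode
  | pair : OracleCode → OracleCode → OracleCode
  | comp : OracleCode → OracleCode → OracleCode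
  | prec : OracleCode → OracleCode → OracleCode
  | rfind : OracleCode → OracleCode

/-- The Turing functional given by an oracle program: `Φ.eval g` is the partial function
computed by the program `Φ` when it is run with oracle `g`. -/
def OracleCode.eval (g : ℕ →. ℕ) : OracleCode → ℕ →. ℕ
  | zero => fun _ => Part.some 0
  | succ => fun n => Part.some (n + 1)
  | left => fun n => Part.some (Nat.unpair n).1
  | right => fun n => Part.some (Nat.unpair n).2
  | oracle => g
  | pair a b => fun n => Nat.pair <$> a.eval g n <*> b.eval g n
  | comp a b => fun n => b.eval g n >>= a.eval g
  | prec a b => fun p =>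
      (Nat.unpair p).2.rec (a.eval g (Nat.unpair p).1) fun y IH => do
        let i ← IH
        b.eval g (Nat.pair (Nat.unpair p).1 (Nat.pair y i))
  | rfind a => fun n => Nat.rfind fun k => (fun m => m = 0) <$> a.eval g (Nat.pair n k)

/-- The oracle programs compute exactly the functions that are Turing reducible to the oracle. -/
theorem turingReducible_iff_exists_oracleCode {f g : ℕ →. ℕ} :
    TuringReducible f g ↔ ∃ Φ : OracleCode, Φ.eval g = f := by
  rw [TuringReducible, RecursiveIn.iff_nat]
  constructor
  · intro h
    induction h with
    | zero => exact ⟨.zero, rfl⟩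
    | succ => exact ⟨.succ, rfl⟩
    | left => exact ⟨.left, rfl⟩
    | right => exact ⟨.right, rfl⟩
    | oracle f hf => exact ⟨.oracle, (Set.mem_singleton_iff.1 hf).symm⟩
    | pair _ _ ha hb =>
      obtain ⟨a, rfl⟩ := ha
      obtain ⟨b, rfl⟩ := hb
      exact ⟨.pair a b, rfl⟩
    | comp _ _ ha hb =>
      obtain ⟨a, rfl⟩ := ha
      obtain ⟨b, rfl⟩ := hb
      exact ⟨.comp a b, rfl⟩
    | prec _ _ ha hb =>
      obtain ⟨a, rfl⟩ := ha
      obtain ⟨b, rfl⟩ := hb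
      exact ⟨.prec a b, rfl⟩
    | rfind _ ha =>
      obtain ⟨a, rfl⟩ := ha
      exact ⟨.rfind a, rfl⟩
  · rintro ⟨Φ, rfl⟩
    induction Φ with
    | zero => exact .zero
    | succ => exact .succ
    | left => exact .left
    | right => exact .right
    | oracle => exact .oracle g rfl
    | pair a b ha hb => exact .pair ha hb
    | comp a b ha hb => exact .comp ha hb
    | prec a b ha hb => exact .prec ha hb
    | rfind a ha => exact .rfind ha

/-- The characteristic function `χ_A` of a set `A ⊆ ω`, as a (total) element of `ℕ →. ℕ`. -/
noncomputable def charFun (A : Set ℕ) : ℕ →. ℕ := fun n => Part.some (A.indicator 1 n)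

/-- The join `A ⊕ B = {2n | n ∈ A} ∪ {2n + 1 | n ∈ B}`. -/
def setJoin (A B : Set ℕ) : Set ℕ :=
  (fun n => 2 * n) '' A ∪ (fun n => 2 * n + 1) '' B

/-- The space `2^P` of sets `W` of prime numbers, with the product topology of the discrete
two-point space; `W p = true` means that `p` belongs to `W`. -/
abbrev PrimeSets : Type := Nat.Primes → Bool

/-- A set of primes as a subset of `ω`, through the bijection `n ↦ p_n` (with `p_0 = 2`). -/
def primeIndices (W : PrimeSets) : Set ℕ :=
  {n | W ⟨Nat.nth Nat.Prime n, Nat.prime_nth_prime n⟩ = true}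

/-- The subring `R_W = ℤ[1/p : p ∈ W]` of `ℚ`. -/
def ringOf (W : PrimeSets) : Subring ℚ :=
  Subring.closure {q | ∃ p : Nat.Primes, W p = true ∧ q = 1 / ((p : ℕ) : ℚ)}

/-- Hilbert's Tenth Problem for `R`: the polynomials `f ∈ ℤ[X_0, X_1, …]` such that `f = 0` has a
solution in `R`. (Only the finitely many variables that occur in `f` matter.) -/
def HTP (R : Type*) [CommRing R] : Set (MvPolynomial ℕ ℤ) :=
  {f | ∃ x : ℕ → R, MvPolynomial.aeval x f = 0}

/-- The polynomial written out as a list of terms: the pair `(c, [i₁, …, i_k])` stands for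
the term `c * X_{i₁} * ⋯ * X_{i_k}`. -/
noncomputable def polyOfTerms (l : List (ℤ × List ℕ)) : MvPolynomial ℕ ℤ :=
  (l.map fun t => MvPolynomial.C t.1 * (t.2.map MvPolynomial.X).prod).sum

/-- A bijection from `ω` onto `ℤ[X_0, X_1, …]` is computable if some algorithm writes out
the polynomial with index `n` as a list of terms. -/
def IsComputableNumbering (ν : ℕ ≃ MvPolynomial ℕ ℤ) : Prop :=
  ∃ r : ℕ → List (ℤ × List ℕ), Computable r ∧ ∀ n, ν n = polyOfTerms (r n)

/-- `HTP(R)` as a subset of `ω`, with respect to a numbering `ν` of the polynomials. -/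
def HTPIndices (ν : ℕ ≃ MvPolynomial ℕ ℤ) (R : Type*) [CommRing R] : Set ℕ :=
  {n | ν n ∈ HTP R}

/-- The set `A(f)` of those `W` for which `f = 0` has a solution in `R_W`. -/
def solvableSet (f : MvPolynomial ℕ ℤ) : Set PrimeSets :=
  {W | f ∈ HTP (ringOf W)}

/-- `W` is HTP-generic if it lies on the topological boundary of `A(f)` for no polynomial `f`. -/
def IsHTPGeneric (W : PrimeSets) : Prop :=
  W ∉ ⋃ f : MvPolynomial ℕ ℤ, frontier (solvableSet f)

/-! A solution of `f = 0` in `R_W` has finitely many denominators, so `solvableSet f` is open and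
its boundary is nowhere dense. There are countably many polynomials, so the HTP-generic sets are
comeager. If `W` is generic and `f = 0` has no solution in `R_W`, then `W` lies outside the closure
of `solvableSet f`, and a finite set `F` of primes outside `W` is to blame: inverting all primes not
in `F` still gives no solution (`IsHTPGeneric.exists_finset`). Hence both answers have finite
witnesses: a solution whose common denominator is a product of primes of `W`, or such a set `F`. A
single oracle program searches for either (`exists_oracleCode_search`). Every accepted witness is
correct, and for generic `W` one exists.

To check `F` with the oracle `HTP(ℚ)`, integrality at `p` must be existentially definable in `ℚ`,
computably in `p` (`not_dvd_den_iff_exists_certificates`). The definition rests on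
`IntegralityCertificate`, which holds for all integers and only for `p`-integral rationals. It asks
for a number `u` that satisfies several norm equations. For an integer, Dirichlet's theorem supplies
a prime `u`, and reciprocity with Legendre's theorem solves the equations
(`integralityCertificate_int`). If `p` divides the denominator, the equations would make the
parameter `b` a square modulo `p`, or modulo `8` if `p = 2`, which it is not
(`IntegralityCertificate.norm_le_one`).

The reverse reduction works for every `W`: the equation `pX = 1` detects `p ∈ W`, and homogenization
expresses rational solvability inside any subring of `ℚ` (`exists_evalTerms_rationalTerms_iff`). -/

/-! ### Legendre's theorem on ternary quadratic forms -/

/-- Pigeonhole: the box of triples bounded by the three square roots has more than `A * B` points,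
so two of them agree in both residues, and their difference is taken. -/
theorem exists_small_congruent {A B : ℕ} (hA : 0 < A) (hB : 0 < B) (r s : ℤ) :
    ∃ x y z : ℤ, ¬(x = 0 ∧ y = 0 ∧ z = 0) ∧ x ^ 2 ≤ A * B ∧ y ^ 2 ≤ B ∧ z ^ 2 ≤ A ∧
      (B : ℤ) ∣ x - r * y ∧ (A : ℤ) ∣ x - s * z := by
  have : NeZero A := ⟨hA.ne'⟩
  have : NeZero B := ⟨hB.ne'⟩
  set box : Finset (ℕ × ℕ × ℕ) := Finset.range (Nat.sqrt (A * B) + 1) ×ˢ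
    (Finset.range (Nat.sqrt B + 1) ×ˢ Finset.range (Nat.sqrt A + 1)) with hbox
  let φ : ℕ × ℕ × ℕ → ZMod B × ZMod A := fun v =>
    (((v.1 : ℤ) - r * (v.2.1 : ℤ) : ℤ), ((v.1 : ℤ) - s * (v.2.2 : ℤ) : ℤ))
  have hcard : (Finset.univ : Finset (ZMod B × ZMod A)).card < box.card := by
    rw [Finset.card_univ, Fintype.card_prod, ZMod.card, ZMod.card, hbox, Finset.card_product,
      Finset.card_product, Finset.card_range, Finset.card_range, Finset.card_range]
    have h1 := Nat.lt_succ_sqrt' (A * B)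
    have h2 := Nat.lt_succ_sqrt' B
    have h3 := Nat.lt_succ_sqrt' A
    rw [Nat.succ_eq_add_one] at h1 h2 h3
    refine lt_of_pow_lt_pow_left₀ 2 (Nat.zero_le _) ?_
    calc (B * A) ^ 2 = (A * B) * (B * A) := by ring
      _ < (Nat.sqrt (A * B) + 1) ^ 2 * ((Nat.sqrt B + 1) ^ 2 * (Nat.sqrt A + 1) ^ 2) :=
        Nat.mul_lt_mul'' h1 (Nat.mul_lt_mul'' h2 h3)
      _ = _ := by ring
  obtain ⟨v, hv, w, hw, hne, heq⟩ :=
    Finset.exists_ne_map_eq_of_card_lt_of_maps_to hcard (f := φ) (fun _ _ => Finset.mem_univ _)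
  have key : ∀ {a b n : ℕ}, a ∈ Finset.range (Nat.sqrt n + 1) → b ∈ Finset.range (Nat.sqrt n + 1) →
      ((a : ℤ) - b) ^ 2 ≤ n := by
    intro a b n ha hb
    rw [Finset.mem_range, Nat.lt_succ_iff] at ha hb
    have hs : ((Nat.sqrt n : ℕ) : ℤ) ^ 2 ≤ n := by exact_mod_cast Nat.sqrt_le' n
    have : |(a : ℤ) - b| ≤ (Nat.sqrt n : ℕ) := by
      rw [abs_le]; constructor <;> omega
    exact (sq_le_sq' (abs_le.1 this).1 (abs_le.1 this).2).trans hs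
  simp only [hbox, Finset.mem_product] at hv hw
  simp only [φ, Prod.mk.injEq] at heq
  refine ⟨v.1 - w.1, v.2.1 - w.2.1, v.2.2 - w.2.2, ?_, ?_, key hv.2.1 hw.2.1, key hv.2.2 hw.2.2,
    ?_, ?_⟩
  · rintro ⟨h1, h2, h3⟩
    exact hne (Prod.ext (by omega) (Prod.ext (by omega) (by omega)))
  · exact_mod_cast key hv.1 hw.1
  · have := (ZMod.intCast_eq_intCast_iff_dvd_sub _ _ _).1 heq.1.symm
    convert this using 1; ring
  · have := (ZMod.intCast_eq_intCast_iff_dvd_sub _ _ _).1 heq.2.symm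
    convert this using 1; ring

theorem isSquare_of_sq_eq_mul_sq {A : ℕ} {x y : ℤ} (hy : y ≠ 0) (h : x ^ 2 = A * y ^ 2) :
    IsSquare A := by
  have : y ∣ x := (Int.pow_dvd_pow_iff two_ne_zero).1 ⟨A, by rw [h]; ring⟩
  obtain ⟨k, rfl⟩ := this
  have hk : k ^ 2 = A := by
    have : y ^ 2 ≠ 0 := pow_ne_zero _ hy
    apply mul_left_cancel₀ this
    rw [← mul_pow, h]; ring
  exact ⟨k.natAbs, by zify; rw [abs_mul_abs_self]; linarith [hk, sq k]⟩

/-- A special case of Legendre's theorem on ternary quadratic forms. -/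
theorem exists_norm_eq_of_isSquare {A B : ℕ} (hA : 0 < A) (hB : 0 < B) (hco : Nat.Coprime A B)
    (hBsq : ¬ IsSquare B) (hAB : IsSquare (A : ZMod B)) (hBA : IsSquare (B : ZMod A)) :
    ∃ X Y : ℚ, (B : ℚ) = X ^ 2 - A * Y ^ 2 := by
  by_cases hAsq : IsSquare A
  · obtain ⟨a, rfl⟩ := hAsq
    have ha : (a : ℚ) ≠ 0 := by rintro h; simp_all
    -- Here the form splits; these values come from `X + aY = B` and `X - aY = 1`.
    refine ⟨(B + 1) / 2, (B - 1) / (2 * a), ?_⟩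
    push_cast; field_simp; ring
  obtain ⟨r, hr⟩ := hAB
  obtain ⟨s, hs⟩ := hBA
  obtain ⟨r, rfl⟩ := ZMod.intCast_surjective r
  obtain ⟨s, rfl⟩ := ZMod.intCast_surjective s
  have hr' : (B : ℤ) ∣ r ^ 2 - A := by
    apply (ZMod.intCast_eq_intCast_iff_dvd_sub _ _ _).1; push_cast; rw [hr]; ring
  have hs' : (A : ℤ) ∣ s ^ 2 - B := by
    apply (ZMod.intCast_eq_intCast_iff_dvd_sub _ _ _).1; push_cast; rw [hs]; ring
  obtain ⟨x, y, z, hne, hx, hy, hz, hxy, hxz⟩ := exists_small_congruent hA hB r s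
  have hcoZ : IsCoprime (A : ℤ) (B : ℤ) := Nat.isCoprime_iff_coprime.2 hco
  have hdvd : (A * B : ℤ) ∣ x ^ 2 - A * y ^ 2 - B * z ^ 2 := by
    apply hcoZ.mul_dvd
    · obtain ⟨k, hk⟩ := hxz
      obtain ⟨l, hl⟩ := hs'
      exact ⟨k * (x + s * z) + l * z ^ 2 - y ^ 2, by linear_combination (x + s * z) * hk + z ^ 2 * hl⟩
    · obtain ⟨k, hk⟩ := hxy
      obtain ⟨l, hl⟩ := hr'
      exact ⟨k * (x + r * y) + l * y ^ 2 - z ^ 2, by linear_combination (x + r * y) * hk + y ^ 2 * hl⟩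
  obtain ⟨k, hk⟩ := hdvd
  have hA' : (0 : ℤ) < A := by exact_mod_cast hA
  have hB' : (0 : ℤ) < B := by exact_mod_cast hB
  have hABpos : (0 : ℤ) < A * B := mul_pos hA' hB'
  have hAy : A * y ^ 2 ≤ (A * B : ℤ) := mul_le_mul_of_nonneg_left hy hA'.le
  have hBz : B * z ^ 2 ≤ (A * B : ℤ) := by nlinarith
  have hAy0 : 0 ≤ A * y ^ 2 := by positivity
  have hBz0 : 0 ≤ B * z ^ 2 := by positivity
  have hyB : y ^ 2 ≠ B := fun h => hBsq ⟨y.natAbs, by zify; rw [abs_mul_abs_self]; linarith [sq y]⟩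
  -- Since `x² ≤ AB`, a positive `k` forces `y = z = 0` and `x² = AB`; but `AB ∣ x`, whence `AB =
  -- 1`.
  have hk1 : k < 1 := by
    by_contra! hk1
    have h1 : (A * B : ℤ) ≤ A * B * k := by nlinarith
    have hy0 : y = 0 := by
      have : A * y ^ 2 = 0 := by linarith [sq_nonneg y]
      simpa [hA.ne'] using this
    have hz0 : z = 0 := by
      have : B * z ^ 2 = 0 := by linarith [sq_nonneg y]
      simpa [hB.ne'] using this
    subst hy0 hz0
    have hd : (A * B : ℤ) ∣ x := hcoZ.mul_dvd (by simpa using hxz) (by simpa using hxy)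
    have hx2 : x ^ 2 = A * B := by linarith
    have : (A * B : ℤ) ^ 2 ∣ A * B := hx2 ▸ pow_dvd_pow_of_dvd hd 2
    have h4 := Int.le_of_dvd hABpos this
    have h5 : (A * B : ℤ) ≤ 1 := by nlinarith
    have h6 : A = 1 := by
      have : A * B ≤ 1 := by exact_mod_cast h5
      nlinarith
    exact hAsq (h6 ▸ IsSquare.one)
  -- For `k ≤ -2` both `Ay²` and `Bz²` attain their bound `AB`, which would make `B` the square
  -- `y²`.
  have hk2 : -2 < k := by
    by_contra! hk2
    have h1 : A * B * k ≤ (A * B : ℤ) * (-2) := mul_le_mul_of_nonneg_left hk2 hABpos.le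
    have : A * y ^ 2 = (A * B : ℤ) := by nlinarith [sq_nonneg x]
    exact hyB (mul_left_cancel₀ hA'.ne' this)
  have hcases : k = 0 ∨ k = -1 := by omega
  rcases hcases with rfl | rfl
  · have hz0 : z ≠ 0 := by
      rintro rfl
      by_cases hy0 : y = 0
      · subst hy0; exact hne ⟨by simpa using hk, rfl, rfl⟩
      · exact hAsq (isSquare_of_sq_eq_mul_sq hy0 (x := x) (by linarith))
    have hzQ : (z : ℚ) ≠ 0 := by exact_mod_cast hz0
    refine ⟨x / z, y / z, ?_⟩
    have : (x : ℚ) ^ 2 - A * y ^ 2 - B * z ^ 2 = 0 := by exact_mod_cast (by simpa using hk)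
    field_simp
    linarith
  -- Now `x² - Bz² = A(y² - B)`. Multiplying by `y² - B` and using that norms from `ℚ(√B)` are
  -- multiplicative, `(x + z√B)(y + √B)` gives a zero of the form.
  · have hid : (x * y + z * B) ^ 2 - A * (y ^ 2 - B) ^ 2 = B * (x + z * y) ^ 2 := by
      linear_combination (y ^ 2 - B) * hk
    have hw : x + z * y ≠ 0 := by
      intro hw
      rw [hw] at hid
      exact hAsq (isSquare_of_sq_eq_mul_sq (sub_ne_zero.2 hyB) (x := x * y + z * B) (by linarith))
    have hwQ : (x + z * y : ℚ) ≠ 0 := by exact_mod_cast hw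
    refine ⟨(x * y + z * B) / (x + z * y), (y ^ 2 - B) / (x + z * y), ?_⟩
    have : ((x * y + z * B) ^ 2 - A * (y ^ 2 - B) ^ 2 : ℚ) = B * (x + z * y) ^ 2 := by
      exact_mod_cast hid
    rw [div_pow, div_pow, mul_div_assoc', ← sub_div, this, mul_div_cancel_right₀ _ (pow_ne_zero 2 hwQ)]

/-! ### Certificates for integers -/

/-- A certificate for the integrality of `n` at the prime `p`: the quadratic form conditions on an
auxiliary number `u`. The number `b` is a parameter that depends on `p`. -/
def IntegralityCertificate (p b n : ℚ) : Prop :=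
  ∃ u x y x₁ y₁ z w s t : ℚ, u ≠ 0 ∧ u = x ^ 2 + y ^ 2 ∧ u = x₁ ^ 2 - b * y₁ ^ 2 ∧
    b * u = z ^ 2 - p * (p + b) * w ^ 2 ∧ u = s ^ 2 - (1 + 4 * (p * (p + b)) * n ^ 4) * t ^ 2

theorem isSquare_of_jacobiSym {A l : ℕ} [Fact l.Prime] (h : jacobiSym A l = 1) :
    IsSquare (A : ZMod l) := by
  simpa using ZMod.isSquare_of_jacobiSym_eq_one h

theorem isSquare_zmod_mul {m n : ℕ} (h : m.Coprime n) {a : ℕ} (hm : IsSquare (a : ZMod m))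
    (hn : IsSquare (a : ZMod n)) : IsSquare (a : ZMod (m * n)) := by
  obtain ⟨x, hx⟩ := hm
  obtain ⟨y, hy⟩ := hn
  refine ⟨(ZMod.chineseRemainder h).symm (x, y), ?_⟩
  apply (ZMod.chineseRemainder h).injective
  rw [map_mul, RingEquiv.apply_symm_apply, map_natCast]
  exact Prod.ext (by simpa using hx) (by simpa using hy)

/-- Dirichlet's theorem gives a prime `l ≡ b` modulo `8P` with `l ≡ 1` modulo `bc`, and `u = l`
works. As `l ≡ 5` modulo `8`, it is a sum of two squares, and reciprocity lets `b` and `c` inherit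
squareness modulo `l` from `l ≡ 1`. Each remaining equation is then an instance of Legendre's
theorem. -/
theorem integralityCertificate_int {p b : ℕ} (hp : p.Prime) (hb : b % 8 = 5) (hpb : p.Coprime b)
    (n : ℤ) : IntegralityCertificate p b n := by
  set P := p * (p + b) with hP
  obtain ⟨m, hm⟩ : ∃ m : ℕ, (m : ℤ) = n ^ 4 := ⟨n.natAbs ^ 4, by push_cast; rw [Even.pow_abs (by decide)]⟩
  set c := 1 + 4 * P * m with hc
  have hPpos : 0 < P := Nat.mul_pos hp.pos (by have := hp.pos; omega)
  have hbodd : Odd b := Nat.odd_iff.2 (by omega)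
  have hPb : P.Coprime b := by
    rw [hP]
    refine Nat.Coprime.mul_left hpb ?_
    simpa using hpb
  have h8Pb : (8 * P).Coprime b := by
    refine Nat.Coprime.mul_left ?_ hPb
    exact Nat.Coprime.pow_left 3 (Nat.coprime_two_left.2 hbodd)
  have hPc : P.Coprime c := by
    rw [hc, show 1 + 4 * P * m = 1 + P * (4 * m) by ring]
    simp
  have h8Pc : (8 * P).Coprime c := by
    refine Nat.Coprime.mul_left ?_ hPc
    refine Nat.Coprime.pow_left 3 (Nat.coprime_two_left.2 (Nat.odd_iff.2 ?_))
    rw [hc, show 1 + 4 * P * m = 1 + 2 * (2 * P * m) by ring]; omega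
  have hcodd : Odd c := Nat.coprime_two_left.1 (Nat.Coprime.coprime_dvd_left (Dvd.intro (4 * P) (by ring)) h8Pc)
  have hco : (8 * P).Coprime (b * c) := h8Pb.mul_right h8Pc
  obtain ⟨a, ha1, ha2⟩ := Nat.chineseRemainder hco b 1
  have hcoa : a.Coprime (8 * P * (b * c)) := by
    refine Nat.Coprime.mul_right ?_ ?_
    · rw [Nat.Coprime, ha1.gcd_eq]; exact h8Pb.symm
    · rw [Nat.Coprime, ha2.gcd_eq]; simp
  have hne : 8 * P * (b * c) ≠ 0 := by
    have : b ≠ 0 := by omega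
    have : c ≠ 0 := by omega
    positivity
  obtain ⟨l, hlb, hl, hla⟩ := Nat.forall_exists_prime_gt_and_modEq b hne hcoa
  have : Fact l.Prime := ⟨hl⟩
  have hl1 : l ≡ b [MOD 8 * P] := (hla.of_mul_right _).trans ha1
  have hl2 : l ≡ 1 [MOD b * c] := (hla.of_mul_left _).trans ha2
  have hlP : l ≡ b [MOD P] := hl1.of_mul_left _
  have hl8 : l % 8 = 5 := by
    have : l % 8 = b % 8 := hl1.of_mul_right P
    omega
  have hlb1 : l ≡ 1 [MOD b] := hl2.of_mul_right _
  have hlc1 : l ≡ 1 [MOD c] := hl2.of_mul_left _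
  have hlodd : Odd l := Nat.odd_iff.2 (by omega)
  have hlns : ¬ IsSquare l := hl.prime.not_isSquare
  have hJ : ∀ {a : ℕ}, Odd a → l ≡ 1 [MOD a] → jacobiSym a l = 1 := by
    intro a ha h1
    rw [jacobiSym.quadratic_reciprocity_one_mod_four' ha (by omega), jacobiSym.mod_left' (a₂ := 1),
      jacobiSym.one_left]
    exact_mod_cast h1
  have hlc : l.Coprime b := by rw [Nat.Coprime, hlb1.gcd_eq]; simp
  have hlcc : l.Coprime c := by rw [Nat.Coprime, hlc1.gcd_eq]; simp
  have hsq1 : ∀ {a : ℕ}, l ≡ 1 [MOD a] → IsSquare (l : ZMod a) := fun h => by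
    rw [(ZMod.natCast_eq_natCast_iff _ _ _).2 h]; simp
  obtain ⟨x, y, hxy⟩ := Nat.Prime.sq_add_sq (p := l) (by omega)
  obtain ⟨x₁, y₁, h₁⟩ := exists_norm_eq_of_isSquare (A := b) (B := l) (by omega) hl.pos hlc.symm hlns
    (isSquare_of_jacobiSym (hJ hbodd hlb1)) (hsq1 hlb1)
  obtain ⟨s, t, h₃⟩ := exists_norm_eq_of_isSquare (A := c) (B := l) (by omega) hl.pos hlcc.symm hlns
    (isSquare_of_jacobiSym (hJ hcodd hlc1)) (hsq1 hlc1)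
  have hPl : P.Coprime l := by
    rw [Nat.coprime_comm, Nat.Coprime, hlP.gcd_eq]; exact hPb.symm
  have hPsqb : IsSquare (P : ZMod b) := ⟨p, by rw [hP]; push_cast; simp⟩
  -- The symbol depends on its lower entry only modulo `4P`, so `l` may be replaced by `b`; and `P =
  -- p² + bp` is the square `p²` modulo `b`.
  have hPJ : jacobiSym P l = 1 := by
    have h4 : l % (4 * P) = b % (4 * P) := hl1.of_dvd (by exact ⟨2, by ring⟩)
    rw [jacobiSym.mod_right' _ hlodd, h4, ← jacobiSym.mod_right' _ hbodd,
      jacobiSym.mod_left' (a₂ := (p : ℤ) ^ 2), jacobiSym.sq_one']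
    · exact hpb
    · rw [hP]; push_cast
      rw [show (p : ℤ) * (p + b) = p ^ 2 + b * p by ring, Int.add_mul_emod_self_left]
  have hblns : ¬ IsSquare (b * l) := by
    rintro ⟨k, hk⟩
    have h1 : l ∣ k := by
      have : l ∣ k * k := hk ▸ Dvd.intro_left b rfl
      rcases hl.dvd_mul.1 this with h | h <;> exact h
    obtain ⟨j, rfl⟩ := h1
    have : b = l * (j * j) := by
      apply Nat.eq_of_mul_eq_mul_right hl.pos; rw [hk]; ring
    have h2 : l ∣ b := Dvd.intro _ this.symm
    have := Nat.eq_one_of_dvd_coprimes hlc dvd_rfl h2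
    exact hl.one_lt.ne' this
  -- `P` is a square modulo `b` and modulo `l`, and `b * l ≡ b²` modulo `P`.
  obtain ⟨z, w, h₂⟩ := exists_norm_eq_of_isSquare (A := P) (B := b * l) hPpos
    (Nat.mul_pos (by omega) hl.pos) (hPb.mul_right hPl) hblns
    (isSquare_zmod_mul hlc.symm hPsqb (isSquare_of_jacobiSym hPJ))
    ⟨b, by push_cast; rw [(ZMod.natCast_eq_natCast_iff _ _ _).2 hlP]⟩
  refine ⟨l, x, y, x₁, y₁, z, w, s, t, by exact_mod_cast hl.ne_zero, by exact_mod_cast hxy.symm, h₁,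
    ?_, ?_⟩
  · rw [hP] at h₂; push_cast at h₂; linarith
  · have hm' : (n : ℚ) ^ 4 = m := by exact_mod_cast hm.symm
    rw [hc, hP] at h₃; push_cast at h₃; rw [hm']; linarith

/-! ### Local analysis of the certificate at `p` -/

section Padic

variable {p : ℕ} [Fact p.Prime]

theorem Padic.valuation_eq_of_norm_eq {x y : ℚ_[p]} (h : ‖x‖ = ‖y‖) : x.valuation = y.valuation := by
  by_cases hx : x = 0
  · subst hx
    rw [norm_zero, eq_comm, norm_eq_zero] at h
    rw [h]
  have hy : y ≠ 0 := by
    rintro rfl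
    exact hx (norm_eq_zero.1 (by rw [h, norm_zero]))
  rw [Padic.norm_eq_zpow_neg_valuation hx, Padic.norm_eq_zpow_neg_valuation hy] at h
  have hp : (1 : ℝ) < p := by exact_mod_cast (Fact.out : p.Prime).one_lt
  have := zpow_right_injective₀ (by linarith) hp.ne' h
  simpa using this

theorem Padic.norm_sub_eq_left {x y : ℚ_[p]} (h : ‖y‖ < ‖x‖) : ‖x - y‖ = ‖x‖ := by
  rw [sub_eq_add_neg, Padic.add_eq_max_of_ne (by rw [norm_neg]; exact h.ne'), norm_neg,
    max_eq_left h.le]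

theorem Padic.norm_sub_eq_right {x y : ℚ_[p]} (h : ‖x‖ < ‖y‖) : ‖x - y‖ = ‖y‖ := by
  rw [norm_sub_rev, Padic.norm_sub_eq_left h]

theorem Padic.even_valuation_sq (x : ℚ_[p]) : Even (x ^ 2).valuation := by
  rw [Padic.valuation_pow]; exact ⟨x.valuation, by push_cast; ring⟩

theorem Padic.even_valuation_sq_mul {x : ℚ_[p]} (y : ℚ_[p]) (hx : Even x.valuation) :
    Even (y ^ 2 * x).valuation := by
  by_cases hx0 : x = 0
  · subst hx0; simp
  by_cases hy0 : y = 0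
  · subst hy0; simp
  rw [Padic.valuation_mul (pow_ne_zero 2 hy0) hx0]
  exact (Padic.even_valuation_sq y).add hx

theorem PadicInt.toZModPow_eq_zero_iff (n : ℕ) (x : ℤ_[p]) :
    PadicInt.toZModPow n x = 0 ↔ ‖x‖ ≤ (p : ℝ) ^ (-n : ℤ) := by
  rw [PadicInt.norm_le_pow_iff_mem_span_pow, ← PadicInt.ker_toZModPow, RingHom.mem_ker]

theorem PadicInt.norm_lt_one_iff_toZMod (x : ℤ_[p]) : ‖x‖ < 1 ↔ PadicInt.toZMod x = 0 := by
  rw [← RingHom.mem_ker, PadicInt.ker_toZMod, IsLocalRing.mem_maximalIdeal, PadicInt.mem_nonunits]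

theorem PadicInt.norm_eq_one_iff_toZMod (x : ℤ_[p]) : ‖x‖ = 1 ↔ PadicInt.toZMod x ≠ 0 := by
  rw [ne_eq, ← PadicInt.norm_lt_one_iff_toZMod, not_lt]
  exact ⟨fun h => h.ge, fun h => le_antisymm (PadicInt.norm_le_one x) h⟩

theorem natCast_zmod_eight {b : ℕ} (hb8 : b % 8 = 5) : ((b : ℕ) : ZMod (2 ^ 3)) = 5 :=
  (ZMod.natCast_eq_natCast_iff b 5 _).2 hb8

theorem PadicInt.toZModPow_three_of_norm_eq_one {w : ℤ_[2]} (hw : ‖w‖ = 1) :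
    PadicInt.toZModPow 3 w ^ 2 = 1 := by
  obtain ⟨v, hv⟩ := PadicInt.isUnit_iff.2 hw
  have hu : IsUnit (PadicInt.toZModPow 3 w) := (hv ▸ v.isUnit).map _
  generalize PadicInt.toZModPow 3 w = a at hu
  revert a; decide

/-- If `b` is not a square modulo `p` (and is `5` modulo `8` if `p = 2`), then all values of
`X² - b` have an even valuation. -/
theorem Padic.even_valuation_sq_sub {b : ℕ} (hb8 : b % 8 = 5)
    (hres : p ≠ 2 → ¬ IsSquare (b : ZMod p)) (w : ℚ_[p]) : Even (w ^ 2 - b).valuation := by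
  have hb1 : ‖(b : ℚ_[p])‖ ≤ 1 := by exact_mod_cast Padic.norm_int_le_one (p := p) b
  by_cases hw : ‖w‖ ≤ 1
  · obtain ⟨w, rfl⟩ : ∃ v : ℤ_[p], (v : ℚ_[p]) = w := ⟨⟨w, hw⟩, rfl⟩
    have hcast : ((w : ℚ_[p]) ^ 2 - b) = ((w ^ 2 - b : ℤ_[p]) : ℚ_[p]) := by push_cast; rfl
    by_cases hunit : PadicInt.toZMod (w ^ 2 - (b : ℤ_[p])) = 0
    · by_cases hp : p = 2
      · subst hp
        have hb2 : ((b : ℕ) : ZMod 2) = 1 := by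
          have : ((b : ℕ) : ZMod 2) = ((1 : ℕ) : ZMod 2) :=
            (ZMod.natCast_eq_natCast_iff _ _ _).2 (show b % 2 = 1 by omega)
          simpa using this
        have hw1 : ‖w‖ = 1 := by
          rw [PadicInt.norm_eq_one_iff_toZMod]
          intro h
          rw [map_sub, map_pow, h, map_natCast, hb2] at hunit
          norm_num at hunit
        -- For odd `w` one has `w² ≡ 1` and `b ≡ 5` modulo `8`, so `w² - b ≡ 4` has valuation
        -- exactly `2`.
        have hle : ‖(w ^ 2 - (b : ℤ_[2])) - 4‖ ≤ ((2 : ℕ) : ℝ) ^ (-(3 : ℕ) : ℤ) := by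
          rw [← PadicInt.toZModPow_eq_zero_iff, map_sub, map_sub, map_pow, map_natCast,
            natCast_zmod_eight hb8, PadicInt.toZModPow_three_of_norm_eq_one hw1, map_ofNat]
          decide
        have h4 : ‖(4 : ℤ_[2])‖ = ((2 : ℕ) : ℝ) ^ (-(2 : ℕ) : ℤ) := by
          have : (4 : ℤ_[2]) = ((2 : ℕ) : ℤ_[2]) ^ 2 := by push_cast; norm_num
          rw [this, PadicInt.norm_p_pow]
        have hn : ‖w ^ 2 - (b : ℤ_[2])‖ = ‖(4 : ℤ_[2])‖ := by
          rw [← norm_neg (4 : ℤ_[2])]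
          apply PadicInt.norm_eq_of_norm_add_lt_right
          rw [← sub_eq_add_neg, norm_neg, h4]
          exact hle.trans_lt (zpow_lt_zpow_right₀ (by norm_num) (by norm_num))
        have hn' : ‖((w : ℚ_[2]) ^ 2 - b)‖ = ‖(2 : ℚ_[2]) ^ 2‖ := by
          rw [hcast, show (2 : ℚ_[2]) ^ 2 = ((4 : ℤ_[2]) : ℚ_[2]) by
            rw [show (4 : ℤ_[2]) = 2 ^ 2 by norm_num]; push_cast; rfl]
          exact hn
        rw [Padic.valuation_eq_of_norm_eq hn']
        exact Padic.even_valuation_sq _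
      · refine absurd ⟨PadicInt.toZMod w, ?_⟩ (hres hp)
        rw [map_sub, map_pow, map_natCast, sub_eq_zero] at hunit
        rw [← hunit, sq]
    · have : ‖((w : ℚ_[p]) ^ 2 - b)‖ = ‖(1 : ℚ_[p])‖ := by
        rw [hcast, norm_one]; exact (PadicInt.norm_eq_one_iff_toZMod _).2 hunit
      rw [Padic.valuation_eq_of_norm_eq this, Padic.valuation_one]
      exact Even.zero
  · have : ‖w ^ 2 - b‖ = ‖w ^ 2‖ := by
      apply Padic.norm_sub_eq_left
      rw [norm_pow]
      exact hb1.trans_lt (one_lt_pow₀ (not_le.1 hw) two_ne_zero)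
    rw [Padic.valuation_eq_of_norm_eq this]
    exact Padic.even_valuation_sq w

theorem Padic.even_valuation_norm {b : ℕ} (hb8 : b % 8 = 5)
    (hres : p ≠ 2 → ¬ IsSquare (b : ZMod p)) (x y : ℚ_[p]) :
    Even (x ^ 2 - b * y ^ 2).valuation := by
  by_cases hy : y = 0
  · subst hy; simp
  · rw [show x ^ 2 - b * y ^ 2 = y ^ 2 * ((x / y) ^ 2 - b) by field_simp]
    exact Padic.even_valuation_sq_mul y (Padic.even_valuation_sq_sub hb8 hres _)

/-- A value of even valuation of `X² - d Y²`, where `d` has an odd valuation, is a square times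
a `1`-unit. -/
theorem Padic.exists_eq_sq_mul_one_sub {u s d t : ℚ_[p]} (hu : u ≠ 0) (hev : Even u.valuation)
    (hd : Odd d.valuation) (h : u = s ^ 2 - d * t ^ 2) :
    s ≠ 0 ∧ ∃ ε : ℤ_[p], ‖ε‖ < 1 ∧ (ε = 0 ∨ Odd (ε : ℚ_[p]).valuation) ∧ u = s ^ 2 * (1 - ε) := by
  have hd0 : d ≠ 0 := by
    rintro rfl
    simp at hd
  by_cases ht : t = 0
  · subst ht
    have hs : s ≠ 0 := by rintro rfl; simp [h] at hu
    exact ⟨hs, 0, by simp, Or.inl rfl, by simpa using h⟩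
  have hodd : Odd (d * t ^ 2).valuation := by
    rw [Padic.valuation_mul hd0 (pow_ne_zero 2 ht)]
    exact hd.add_even (Padic.even_valuation_sq t)
  -- The two terms have valuations of different parity, so one dominates; if it were `d * t ^ 2`,
  -- the valuation of `u` would be odd.
  have hlt : ‖d * t ^ 2‖ < ‖s ^ 2‖ := by
    by_contra! hle
    rcases hle.lt_or_eq with hlt | heq
    · have := Padic.valuation_eq_of_norm_eq (Padic.norm_sub_eq_right hlt)
      rw [← h] at this
      rw [← this] at hodd
      exact Int.not_even_iff_odd.2 hodd hev
    · have := Padic.valuation_eq_of_norm_eq heq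
      rw [← this] at hodd
      exact Int.not_even_iff_odd.2 hodd (Padic.even_valuation_sq s)
  have hs : s ≠ 0 := by
    rintro rfl
    rw [zero_pow two_ne_zero, norm_zero] at hlt
    exact not_lt_of_ge (norm_nonneg _) hlt
  have hs2 : ‖s ^ 2‖ ≠ 0 := norm_ne_zero_iff.2 (pow_ne_zero 2 hs)
  have hε : ‖d * t ^ 2 / s ^ 2‖ < 1 := by
    rw [norm_div, div_lt_one ((norm_nonneg _).lt_of_ne' hs2)]; exact hlt
  refine ⟨hs, ⟨d * t ^ 2 / s ^ 2, hε.le⟩, hε, Or.inr ?_, ?_⟩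
  · change Odd (d * t ^ 2 / s ^ 2).valuation
    rw [div_eq_mul_inv, Padic.valuation_mul (mul_ne_zero hd0 (pow_ne_zero 2 ht))
      (inv_ne_zero (pow_ne_zero 2 hs)), Padic.valuation_inv]
    exact hodd.add_even (Padic.even_valuation_sq s).neg
  · change u = s ^ 2 * (1 - d * t ^ 2 / s ^ 2)
    rw [h]; field_simp

/-- Since `-1` is not a square modulo `4`, the sum `(x / y)² + 1` has norm above `1 / 4`, too large
to compensate `‖y‖² ≥ 4`. -/
theorem Padic.norm_le_one_of_sq_add_sq {x y : ℚ_[2]} (h : ‖x ^ 2 + y ^ 2‖ ≤ 1) : ‖y‖ ≤ 1 := by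
  by_contra! hy
  have hy0 : y ≠ 0 := by rintro rfl; simp at hy; linarith
  have hval : y.valuation ≤ -1 := by
    by_contra! hv
    exact not_le_of_gt hy ((Padic.norm_le_one_iff_val_nonneg y).2 (by omega))
  have hy2 : (2 : ℝ) ≤ ‖y‖ := by
    rw [Padic.norm_eq_zpow_neg_valuation hy0]
    calc (2 : ℝ) = ((2 : ℕ) : ℝ) ^ (1 : ℤ) := by norm_num
      _ ≤ _ := zpow_le_zpow_right₀ (by norm_num) (by omega)
  have hw : (1 / 4 : ℝ) < ‖(x / y) ^ 2 + 1‖ := by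
    by_cases hw1 : ‖x / y‖ ≤ 1
    · obtain ⟨w, hw⟩ : ∃ v : ℤ_[2], (v : ℚ_[2]) = x / y := ⟨⟨_, hw1⟩, rfl⟩
      rw [← hw]
      by_contra! hle
      have h0 : PadicInt.toZModPow 2 (w ^ 2 + 1) = 0 := by
        rw [PadicInt.toZModPow_eq_zero_iff]
        refine le_trans ?_ (hle.trans (by norm_num))
        rw [PadicInt.norm_def]; push_cast; rfl
      rw [map_add, map_pow, map_one] at h0
      generalize PadicInt.toZModPow 2 w = a at h0
      revert a; decide
    · have : 1 < ‖(x / y) ^ 2‖ := by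
        rw [norm_pow]; exact one_lt_pow₀ (not_le.1 hw1) two_ne_zero
      rw [Padic.add_eq_max_of_ne (by rw [norm_one]; exact this.ne')]
      exact lt_max_of_lt_left (by linarith)
  rw [show x ^ 2 + y ^ 2 = y ^ 2 * ((x / y) ^ 2 + 1) by field_simp, norm_mul, norm_pow] at h
  have : 4 ≤ ‖y‖ ^ 2 := by nlinarith
  nlinarith

/-- An odd positive valuation is `1` or at least `3`. If it were `1`, then `1 - ε ≡ 3` modulo `4`,
while `β ≡ 1` and a sum of two squares is never `3` modulo `4`. -/
theorem PadicInt.toZModPow_three_eq_zero_of_sq_add_sq {β ε : ℤ_[2]} {x y : ℚ_[2]}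
    (hβ : PadicInt.toZModPow 2 β = 1) (hε1 : ‖ε‖ < 1)
    (hε : ε = 0 ∨ Odd (ε : ℚ_[2]).valuation) (h : β * (x ^ 2 + y ^ 2) = 1 - ε) :
    PadicInt.toZModPow 3 ε = 0 := by
  rcases hε with rfl | hε
  · exact map_zero _
  have hβ1 : ‖β‖ = 1 := by
    refine le_antisymm (PadicInt.norm_le_one _) (le_of_not_gt fun hlt => ?_)
    obtain ⟨c, rfl⟩ := PadicInt.norm_lt_one_iff_dvd β |>.1 hlt
    rw [map_mul, map_natCast] at hβ
    generalize PadicInt.toZModPow 2 c = a at hβ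
    revert a; decide
  have hn : ‖x ^ 2 + y ^ 2‖ ≤ 1 := by
    have h1 : ‖(β : ℚ_[2])‖ = 1 := hβ1
    have h2 : ‖(1 : ℚ_[2]) - ε‖ ≤ 1 := by
      have := PadicInt.norm_le_one (1 - ε)
      rw [PadicInt.norm_def] at this
      exact_mod_cast this
    rw [← h, norm_mul, h1, one_mul] at h2
    exact h2
  obtain ⟨y, rfl⟩ : ∃ v : ℤ_[2], (v : ℚ_[2]) = y := ⟨⟨y, Padic.norm_le_one_of_sq_add_sq hn⟩, rfl⟩
  obtain ⟨x, rfl⟩ : ∃ v : ℤ_[2], (v : ℚ_[2]) = x :=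
    ⟨⟨x, Padic.norm_le_one_of_sq_add_sq (x := y) (by rwa [add_comm])⟩, rfl⟩
  have hZ : β * (x ^ 2 + y ^ 2) = 1 - ε := Subtype.coe_injective (by push_cast; exact h)
  have hε0 : (ε : ℚ_[2]) ≠ 0 := by
    intro h0; rw [h0] at hε; simp at hε
  have hεnorm : ‖ε‖ = ((2 : ℕ) : ℝ) ^ (-(ε : ℚ_[2]).valuation) := by
    rw [PadicInt.norm_def, Padic.norm_eq_zpow_neg_valuation hε0]
  have hpos : 1 ≤ (ε : ℚ_[2]).valuation := by
    by_contra! hv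
    rw [hεnorm] at hε1
    exact not_le_of_gt hε1 (one_le_zpow₀ (by norm_num) (by omega))
  by_cases h3 : 3 ≤ (ε : ℚ_[2]).valuation
  · rw [PadicInt.toZModPow_eq_zero_iff, hεnorm]
    exact zpow_le_zpow_right₀ (by norm_num) (by simpa using h3)
  exfalso
  have hv1 : (ε : ℚ_[2]).valuation = 1 := by
    obtain ⟨k, hk⟩ := hε; omega
  obtain ⟨c, hc⟩ := PadicInt.norm_lt_one_iff_dvd ε |>.1 hε1
  have hc1 : PadicInt.toZModPow 2 ε ≠ 0 := by
    rw [ne_eq, PadicInt.toZModPow_eq_zero_iff, hεnorm, hv1]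
    norm_num
  have hmod := congrArg (PadicInt.toZModPow 2) hZ
  rw [map_mul, hβ, one_mul, map_add, map_pow, map_pow, map_sub, map_one] at hmod
  rw [hc, map_mul, map_natCast] at hc1 hmod
  generalize PadicInt.toZModPow 2 c = a at hc1 hmod
  generalize PadicInt.toZModPow 2 x = a₁ at hmod
  generalize PadicInt.toZModPow 2 y = a₂ at hmod
  revert a a₁ a₂; decide

/-- If `n` has a pole at `p`, both `p(p + b)` and `1 + 4p(p + b)n⁴` have odd valuation, whereas `u`
has even valuation by the choice of `b`. So `u` and `bu` are both squares times `1`-units, hence so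
is `b`, against the choice of `b`. -/
theorem IntegralityCertificate.norm_le_one {b : ℕ} {n : ℚ} (h : IntegralityCertificate p b n)
    (hb8 : b % 8 = 5) (hpb : p.Coprime b) (hres : p ≠ 2 → ¬ IsSquare (b : ZMod p)) :
    ‖(n : ℚ_[p])‖ ≤ 1 := by
  have hp : p.Prime := Fact.out
  obtain ⟨u, x, y, x₁, y₁, z, w, s, t, hu, h1, h2, h3, h4⟩ := h
  by_contra! hn
  have hn0 : (n : ℚ_[p]) ≠ 0 := by
    intro h0; rw [h0, norm_zero] at hn; linarith
  have hnv : (n : ℚ_[p]).valuation ≤ -1 := by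
    by_contra! hv
    exact not_le_of_gt hn ((Padic.norm_le_one_iff_val_nonneg _).2 (by omega))
  have hu' : (u : ℚ_[p]) ≠ 0 := by exact_mod_cast hu
  have h1' : (u : ℚ_[p]) = x ^ 2 + y ^ 2 := by rw [h1]; push_cast; rfl
  have h2' : (u : ℚ_[p]) = x₁ ^ 2 - b * y₁ ^ 2 := by rw [h2]; push_cast; rfl
  have h3' : (b : ℚ_[p]) * u = z ^ 2 - p * (p + b) * w ^ 2 := by exact_mod_cast congrArg (Rat.cast : ℚ → ℚ_[p]) h3
  have h4' : (u : ℚ_[p]) = s ^ 2 - (1 + 4 * (p * (p + b)) * n ^ 4) * t ^ 2 := by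
    exact_mod_cast congrArg (Rat.cast : ℚ → ℚ_[p]) h4
  have hb1 : ‖(b : ℚ_[p])‖ = 1 := Padic.norm_natCast_eq_one_iff.2 hpb
  have hb0 : (b : ℚ_[p]) ≠ 0 := norm_ne_zero_iff.1 (by rw [hb1]; norm_num)
  have hpb1 : ‖((p : ℚ_[p]) + b)‖ = 1 := by
    have : ‖((p + b : ℕ) : ℚ_[p])‖ = 1 := Padic.norm_natCast_eq_one_iff.2 (by simpa using hpb)
    exact_mod_cast this
  have hval1 : ∀ {a : ℚ_[p]}, ‖a‖ = 1 → a.valuation = 0 := fun ha => by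
    rw [Padic.valuation_eq_of_norm_eq (ha.trans norm_one.symm), Padic.valuation_one]
  have hpb0 : (p : ℚ_[p]) + b ≠ 0 := norm_ne_zero_iff.1 (by rw [hpb1]; norm_num)
  have hp0 : (p : ℚ_[p]) ≠ 0 := by exact_mod_cast hp.ne_zero
  have hPval : ((p : ℚ_[p]) * (p + b)).valuation = 1 := by
    rw [Padic.valuation_mul hp0 hpb0, Padic.valuation_p, hval1 hpb1, add_zero]
  have hev : Even (u : ℚ_[p]).valuation := h2' ▸ Padic.even_valuation_norm hb8 hres _ _
  have hev' : Even ((b : ℚ_[p]) * u).valuation := by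
    rw [Padic.valuation_mul hb0 hu', hval1 hb1, zero_add]; exact hev
  have hfour : ((4 : ℚ_[p])).valuation = 2 * (2 : ℚ_[p]).valuation := by
    rw [show (4 : ℚ_[p]) = 2 ^ 2 by norm_num, Padic.valuation_pow]; norm_num
  have htwo : (2 : ℚ_[p]).valuation ≤ 1 := by
    by_cases hp2 : p = 2
    · subst hp2
      have := Padic.valuation_p (p := 2)
      exact_mod_cast this.le
    · have : ‖((2 : ℕ) : ℚ_[p])‖ = 1 :=
        Padic.norm_natCast_eq_one_iff.2 ((Nat.coprime_primes hp Nat.prime_two).2 hp2)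
      have := hval1 this
      push_cast at this
      omega
  have hc0 : (4 : ℚ_[p]) * (p * (p + b)) * n ^ 4 ≠ 0 :=
    mul_ne_zero (mul_ne_zero (by norm_num) (mul_ne_zero hp0 hpb0)) (pow_ne_zero 4 hn0)
  have hcval : ((4 : ℚ_[p]) * (p * (p + b)) * n ^ 4).valuation =
      2 * (2 : ℚ_[p]).valuation + 1 + 4 * (n : ℚ_[p]).valuation := by
    rw [Padic.valuation_mul (mul_ne_zero (by norm_num) (mul_ne_zero hp0 hpb0)) (pow_ne_zero 4 hn0),
      Padic.valuation_mul (by norm_num) (mul_ne_zero hp0 hpb0), hPval, hfour, Padic.valuation_pow]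
    norm_num
  -- The fourth power of `n` is what outweighs the factor `4` when `p = 2`: the total valuation is
  -- at most `2 + 1 - 4`.
  have hcodd : Odd (1 + 4 * (p * (p + b)) * (n : ℚ_[p]) ^ 4).valuation := by
    have hlt : ‖(1 : ℚ_[p])‖ < ‖(4 : ℚ_[p]) * (p * (p + b)) * n ^ 4‖ := by
      rw [norm_one]
      by_contra! hle
      rw [Padic.norm_le_one_iff_val_nonneg, hcval] at hle
      omega
    have : ‖1 + 4 * (p * (p + b)) * (n : ℚ_[p]) ^ 4‖ = ‖(4 : ℚ_[p]) * (p * (p + b)) * n ^ 4‖ := by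
      rw [Padic.add_eq_max_of_ne hlt.ne, max_eq_right hlt.le]
    rw [Padic.valuation_eq_of_norm_eq this, hcval]
    exact ⟨(2 : ℚ_[p]).valuation + 2 * (n : ℚ_[p]).valuation, by ring⟩
  obtain ⟨hs, ε₁, hε₁, hε₁', hus⟩ := Padic.exists_eq_sq_mul_one_sub hu' hev hcodd h4'
  obtain ⟨hz, ε₂, hε₂, hε₂', hbz⟩ := Padic.exists_eq_sq_mul_one_sub (mul_ne_zero hb0 hu') hev'
    (by rw [hPval]; exact odd_one) h3'
  have hratio : ((z : ℚ_[p]) / s) ^ 2 * (1 - ε₂) = b * (1 - ε₁) := by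
    have : (z : ℚ_[p]) ^ 2 * (1 - ε₂) = b * (s ^ 2 * (1 - ε₁)) := by rw [← hbz, ← hus]
    field_simp
    linear_combination this
  have hone : ∀ {ε : ℤ_[p]}, ‖ε‖ < 1 → ‖(1 : ℚ_[p]) - ε‖ = 1 := fun {ε} hε => by
    rw [Padic.norm_sub_eq_left, norm_one]; rw [norm_one]; exact hε
  have hr1 : ‖(z : ℚ_[p]) / s‖ = 1 := by
    have := congrArg norm hratio
    rw [norm_mul, norm_mul, hone hε₁, hone hε₂, hb1, norm_pow, mul_one, mul_one] at this
    exact (pow_eq_one_iff_of_nonneg (norm_nonneg _) two_ne_zero).1 this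
  obtain ⟨r, hr⟩ : ∃ v : ℤ_[p], (v : ℚ_[p]) = z / s := ⟨⟨_, hr1.le⟩, rfl⟩
  rw [← hr] at hratio hr1
  have hZ : r ^ 2 * (1 - ε₂) = b * (1 - ε₁) := Subtype.coe_injective (by push_cast; exact hratio)
  -- Reduction modulo `p` suffices for odd `p`. For `p = 2` the contradiction appears only modulo
  -- `8`, and the equation `u = x² + y²` serves to make `ε₁` and `ε₂` vanish there.
  by_cases hp2 : p = 2
  · subst hp2
    have hus' : ((1 : ℤ_[2]) : ℚ_[2]) * ((x / s) ^ 2 + (y / s) ^ 2) = 1 - ε₁ := by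
      have hs' := pow_ne_zero 2 hs
      apply mul_left_cancel₀ hs'
      rw [← hus, h1']; push_cast; field_simp
    have hbz' : (((b : ℕ) : ℤ_[2]) : ℚ_[2]) * ((x / z) ^ 2 + (y / z) ^ 2) = 1 - ε₂ := by
      have hz' := pow_ne_zero 2 hz
      apply mul_left_cancel₀ hz'
      rw [← hbz, h1']; push_cast; field_simp
    have e1 := PadicInt.toZModPow_three_eq_zero_of_sq_add_sq (map_one _) hε₁ hε₁' hus'
    have e2 := PadicInt.toZModPow_three_eq_zero_of_sq_add_sq (by
      rw [map_natCast]
      exact (ZMod.natCast_eq_natCast_iff b 1 _).2 (show b % 4 = 1 by omega)) hε₂ hε₂' hbz'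
    have := congrArg (PadicInt.toZModPow 3) hZ
    rw [map_mul, map_mul, map_sub, map_sub, e1, e2, map_pow,
      PadicInt.toZModPow_three_of_norm_eq_one hr1, map_one, map_natCast, natCast_zmod_eight hb8] at this
    revert this; decide
  · apply hres hp2
    have := congrArg PadicInt.toZMod hZ
    rw [map_mul, map_mul, map_sub, map_sub, (PadicInt.norm_lt_one_iff_toZMod ε₁).1 hε₁,
      (PadicInt.norm_lt_one_iff_toZMod ε₂).1 hε₂, map_pow, map_one, map_natCast, sub_zero, mul_one,
      mul_one] at this
    exact ⟨_, by rw [← this, sq]⟩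

end Padic

/-! ### Existential definition of `p`-integrality -/

/-- The parameters `b` for which `IntegralityCertificate p b` certifies integrality at `p`. -/
def IsCertificateParam (p b : ℕ) : Prop :=
  p.Prime ∧ b % 8 = 5 ∧ (p = 2 ∨ ∀ x < p, x * x % p ≠ b % p)

theorem IsCertificateParam.coprime {p b : ℕ} (h : IsCertificateParam p b) : p.Coprime b := by
  obtain ⟨hp, hb8, rfl | hres⟩ := h
  · exact Nat.coprime_two_left.2 (Nat.odd_iff.2 (by omega))
  · rw [hp.coprime_iff_not_dvd]
    intro hdvd
    exact hres 0 hp.pos (by rw [Nat.mod_eq_zero_of_dvd hdvd]; simp)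

theorem IsCertificateParam.not_isSquare {p b : ℕ} (h : IsCertificateParam p b) (h2 : p ≠ 2) :
    ¬ IsSquare (b : ZMod p) := by
  rintro ⟨x, hx⟩
  have : NeZero p := ⟨h.1.ne_zero⟩
  refine (h.2.2.resolve_left h2) x.val (ZMod.val_lt x) ?_
  have : ((x.val * x.val : ℕ) : ZMod p) = (b : ℕ) := by
    push_cast; rw [ZMod.natCast_zmod_val, hx]
  exact (ZMod.natCast_eq_natCast_iff _ _ _).1 this

theorem exists_isCertificateParam {p : ℕ} (hp : p.Prime) : ∃ b, IsCertificateParam p b := by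
  by_cases h2 : p = 2
  · exact ⟨5, hp, rfl, Or.inl h2⟩
  have : Fact p.Prime := ⟨hp⟩
  obtain ⟨a, ha⟩ := FiniteField.exists_nonsquare (F := ZMod p) (by rwa [ZMod.ringChar_zmod_n])
  have hco : Nat.Coprime 8 p := by
    refine Nat.Coprime.pow_left 3 ((Nat.coprime_primes Nat.prime_two hp).2 (Ne.symm h2))
  obtain ⟨b, hb1, hb2⟩ := Nat.chineseRemainder hco 5 a.val
  refine ⟨b, hp, hb1, Or.inr fun x _ hx => ha ⟨x, ?_⟩⟩
  have h3 : x * x ≡ a.val [MOD p] := Nat.ModEq.trans hx hb2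
  have := (ZMod.natCast_eq_natCast_iff _ _ _).2 h3
  rw [ZMod.natCast_zmod_val] at this
  rw [← this]; push_cast; rfl

/-- The ring of `p`-integral rational numbers is existentially definable in `ℚ`. -/
theorem not_dvd_den_iff_exists_certificates {p b : ℕ} (h : IsCertificateParam p b) (t : ℚ) :
    ¬ p ∣ t.den ↔ ∃ n s : ℚ, IntegralityCertificate p b n ∧ IntegralityCertificate p b s ∧
      t * (1 - p * s) = n := by
  have : Fact p.Prime := ⟨h.1⟩
  constructor
  · intro ht
    have hco : IsCoprime (p : ℤ) (t.den : ℤ) :=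
      Nat.isCoprime_iff_coprime.2 (h.1.coprime_iff_not_dvd.2 ht)
    -- By Bézout, `1 - ps = e * t.den`, a multiple of the denominator of `t`; so `t(1 - ps)` is an
    -- integer.
    obtain ⟨s, e, hse⟩ := hco
    refine ⟨(t.num * e : ℤ), (s : ℤ), integralityCertificate_int h.1 h.2.1 h.coprime _,
      integralityCertificate_int h.1 h.2.1 h.coprime _, ?_⟩
    have hse' : (s : ℚ) * p + e * t.den = 1 := by exact_mod_cast hse
    rw [show (1 : ℚ) - p * s = e * t.den by linarith]
    push_cast
    rw [← Rat.mul_den_eq_num t]; ring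
  · rintro ⟨n, s, hn, hs, heq⟩ hdvd
    have hn1 := hn.norm_le_one h.2.1 h.coprime h.not_isSquare
    have hs1 := hs.norm_le_one h.2.1 h.coprime h.not_isSquare
    have hps : ‖(p : ℚ_[p]) * s‖ < 1 := by
      rw [norm_mul]
      calc ‖(p : ℚ_[p])‖ * ‖(s : ℚ_[p])‖ ≤ ‖(p : ℚ_[p])‖ * 1 := by gcongr
        _ < 1 := by rw [mul_one]; exact Padic.norm_p_lt_one
    -- Certified numbers are only known to be `p`-integral, which suffices: `1 - ps` is a unit at
    -- `p`, so `t` is as integral as `n`.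
    have hunit : ‖(1 : ℚ_[p]) - p * s‖ = 1 := by
      rw [Padic.norm_sub_eq_left, norm_one]; rwa [norm_one]
    have heq' : (t : ℚ_[p]) * (1 - p * s) = n := by exact_mod_cast congrArg (Rat.cast : ℚ → ℚ_[p]) heq
    have ht1 : ‖(t : ℚ_[p])‖ ≤ 1 := by
      rw [← heq', norm_mul, hunit, mul_one] at hn1; exact hn1
    have hnum : ‖((t.num : ℤ) : ℚ_[p])‖ < 1 := by
      have h1 : ((t.num : ℤ) : ℚ_[p]) = t * (t.den : ℕ) := by
        exact_mod_cast congrArg (Rat.cast : ℚ → ℚ_[p]) (Rat.mul_den_eq_num t).symm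
      have h2 : ‖((t.den : ℕ) : ℚ_[p])‖ < 1 := Padic.norm_natCast_lt_one_iff.2 hdvd
      rw [h1, norm_mul]
      calc _ ≤ 1 * ‖((t.den : ℕ) : ℚ_[p])‖ := by gcongr
        _ < 1 := by rwa [one_mul]
    have hd := Padic.norm_intCast_lt_one_iff.1 hnum
    have h3 : p ∣ t.num.natAbs := Int.natCast_dvd.1 hd
    have := Nat.eq_one_of_dvd_coprimes t.reduced h3 hdvd
    exact h.1.one_lt.ne' this

/-! ### Term lists and the certificate as a system of equations -/

section Terms

/-- The value of a polynomial that is written out as a list of terms. -/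
def evalTerms {R : Type*} [CommRing R] (x : ℕ → R) (L : List (ℤ × List ℕ)) : R :=
  (L.map fun t => (t.1 : R) * (t.2.map x).prod).sum

variable {R : Type*} [CommRing R]

theorem aeval_polyOfTerms (x : ℕ → R) (L : List (ℤ × List ℕ)) :
    MvPolynomial.aeval x (polyOfTerms L) = evalTerms x L := by
  simp [polyOfTerms, evalTerms, map_list_sum, map_list_prod, Function.comp_def]

@[simp] theorem evalTerms_nil (x : ℕ → R) : evalTerms x [] = 0 := rfl

@[simp] theorem evalTerms_cons (x : ℕ → R) (t : ℤ × List ℕ) (L : List (ℤ × List ℕ)) :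
    evalTerms x (t :: L) = t.1 * (t.2.map x).prod + evalTerms x L := by
  simp [evalTerms]

theorem evalTerms_append (x : ℕ → R) (L L' : List (ℤ × List ℕ)) :
    evalTerms x (L ++ L') = evalTerms x L + evalTerms x L' := by
  simp [evalTerms]

theorem evalTerms_congr {x y : ℕ → R} {L : List (ℤ × List ℕ)}
    (h : ∀ i ∈ L.flatMap Prod.snd, x i = y i) : evalTerms x L = evalTerms y L := by
  unfold evalTerms
  congr 1
  refine List.map_congr_left fun t ht => ?_
  congr 2
  exact List.map_congr_left fun i hi => h i (List.mem_flatMap.2 ⟨t, ht, hi⟩)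

theorem map_evalTerms {S : Type*} [CommRing S] (φ : R →+* S) (x : ℕ → R) (L : List (ℤ × List ℕ)) :
    φ (evalTerms x L) = evalTerms (φ ∘ x) L := by
  simp [evalTerms, map_list_sum, map_list_prod, Function.comp_def]

/-- The product of two polynomials given by lists of terms. -/
def mulTerms (L L' : List (ℤ × List ℕ)) : List (ℤ × List ℕ) :=
  L.flatMap fun t => L'.map fun t' => (t.1 * t'.1, t.2 ++ t'.2)

theorem evalTerms_mulTerms (x : ℕ → R) (L L' : List (ℤ × List ℕ)) :
    evalTerms x (mulTerms L L') = evalTerms x L * evalTerms x L' := by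
  have hone : ∀ t : ℤ × List ℕ, evalTerms x (L'.map fun t' => (t.1 * t'.1, t.2 ++ t'.2)) =
      t.1 * (t.2.map x).prod * evalTerms x L' := by
    intro t
    induction L' with
    | nil => simp
    | cons t' L' ih => simp [ih]; ring
  induction L with
  | nil => simp [mulTerms]
  | cons t L ih =>
    rw [mulTerms] at ih ⊢
    rw [List.flatMap_cons, evalTerms_append, ih, hone, evalTerms_cons]; ring

/-- The sum of the squares of the polynomials in a list. -/
def sumSqTerms (E : List (List (ℤ × List ℕ))) : List (ℤ × List ℕ) :=
  E.flatMap fun e => mulTerms e e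

theorem evalTerms_sumSqTerms_eq_zero_iff {K : Type*} [CommRing K] [LinearOrder K]
    [IsStrictOrderedRing K] (x : ℕ → K) (E : List (List (ℤ × List ℕ))) :
    evalTerms x (sumSqTerms E) = 0 ↔ ∀ e ∈ E, evalTerms x e = 0 := by
  have hnn : ∀ E : List (List (ℤ × List ℕ)), 0 ≤ evalTerms x (sumSqTerms E) := by
    intro E
    induction E with
    | nil => simp [sumSqTerms]
    | cons e E ih =>
      rw [sumSqTerms] at ih ⊢
      rw [List.flatMap_cons, evalTerms_append, evalTerms_mulTerms]
      exact add_nonneg (mul_self_nonneg _) ih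
  induction E with
  | nil => simp [sumSqTerms]
  | cons e E ih =>
    have := hnn E
    rw [List.forall_mem_cons]
    refine Iff.trans ?_ (and_congr mul_self_eq_zero ih)
    rw [sumSqTerms] at this ⊢
    rw [List.flatMap_cons, evalTerms_append, evalTerms_mulTerms]
    exact add_eq_zero_iff_of_nonneg (mul_self_nonneg _) this

/-- Renaming of the variables. -/
def renameTerms (ρ : ℕ → ℕ) (L : List (ℤ × List ℕ)) : List (ℤ × List ℕ) :=
  L.map fun t => (t.1, t.2.map ρ)

theorem evalTerms_renameTerms (x : ℕ → R) (ρ : ℕ → ℕ) (L : List (ℤ × List ℕ)) :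
    evalTerms x (renameTerms ρ L) = evalTerms (x ∘ ρ) L := by
  simp [evalTerms, renameTerms, Function.comp_def]

/-- The equations of `IntegralityCertificate`: the variables `1` and `2` are the parameters, the
variable `n` is to be certified, and the variables from `o` on are auxiliary. -/
def certificateEquations (n o : ℕ) : List (List (ℤ × List ℕ)) :=
  [[(1, [o, o + 1]), (-1, [])],
   [(1, [o]), (-1, [o + 2, o + 2]), (-1, [o + 3, o + 3])],
   [(1, [o]), (-1, [o + 4, o + 4]), (1, [2, o + 5, o + 5])],
   [(1, [2, o]), (-1, [o + 6, o + 6]), (1, [1, 1, o + 7, o + 7]), (1, [1, 2, o + 7, o + 7])],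
   [(1, [o]), (-1, [o + 8, o + 8]), (1, [o + 9, o + 9]), (4, [1, 1, n, n, n, n, o + 9, o + 9]),
    (4, [1, 2, n, n, n, n, o + 9, o + 9])]]

/-- The equations that say that the variable `0` is integral at the variable `1`. -/
def integralityEquations : List (List (ℤ × List ℕ)) :=
  [(1, [0]), (-1, [0, 1, 4]), (-1, [3])] :: (certificateEquations 3 5 ++ certificateEquations 4 15)

/-- The equations that say that the variable `0` is integral at `p`. -/
def integralityEquationsAt (q : ℕ × ℕ) : List (List (ℤ × List ℕ)) :=
  [(1, [1]), (-(q.1 : ℤ), [])] :: [(1, [2]), (-(q.2 : ℤ), [])] :: integralityEquations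

theorem exists_certificateEquations {p b n : ℚ} {v : ℕ → ℚ} {o k : ℕ} (h1 : v 1 = p) (h2 : v 2 = b)
    (hk : v k = n) (h : ∀ e ∈ certificateEquations k o, evalTerms v e = 0) :
    IntegralityCertificate p b n := by
  simp only [certificateEquations, List.forall_mem_cons, evalTerms_cons, evalTerms_nil,
    List.map_cons, List.map_nil, List.prod_cons, List.prod_nil, h1, h2, hk] at h
  obtain ⟨e1, e2, e3, e4, e5, -⟩ := h
  push_cast at e1 e2 e3 e4 e5
  refine ⟨v o, v (o + 2), v (o + 3), v (o + 4), v (o + 5), v (o + 6), v (o + 7), v (o + 8),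
    v (o + 9), ?_, ?_, ?_, ?_, ?_⟩
  · intro h0; rw [h0] at e1; norm_num at e1
  · linarith
  · linarith
  · linarith
  · linarith

theorem exists_integralityEquationsAt_iff {p b : ℕ} (h : IsCertificateParam p b) (t : ℚ) :
    (∃ v : ℕ → ℚ, v 0 = t ∧ ∀ e ∈ integralityEquationsAt (p, b), evalTerms v e = 0) ↔
      ¬ p ∣ t.den := by
  rw [not_dvd_den_iff_exists_certificates h]
  constructor
  · rintro ⟨v, rfl, hv⟩
    simp only [integralityEquationsAt, integralityEquations, List.forall_mem_cons,
      List.forall_mem_append, evalTerms_cons, evalTerms_nil,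
      List.map_cons, List.map_nil, List.prod_cons, List.prod_nil] at hv
    obtain ⟨h1, h2, h3, h4, h5⟩ := hv
    push_cast at h1 h2 h3
    have e1 : v 1 = p := by linarith
    have e2 : v 2 = b := by linarith
    refine ⟨v 3, v 4, exists_certificateEquations e1 e2 rfl h4,
      exists_certificateEquations e1 e2 rfl h5, ?_⟩
    rw [← e1]; linarith
  · rintro ⟨n, s, ⟨u, x, y, x₁, y₁, z, w, c, d, hu, e1, e2, e3, e4⟩,
      ⟨u', x', y', x₁', y₁', z', w', c', d', hu', e1', e2', e3', e4'⟩, heq⟩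
    -- Variables `0` to `4` hold `t, p, b, n, s`; the two certificates occupy the blocks from `5`
    -- and from `15`. The inverse of `u` witnesses `u ≠ 0`.
    refine ⟨fun i => [t, p, b, n, s, u, u⁻¹, x, y, x₁, y₁, z, w, c, d,
      u', u'⁻¹, x', y', x₁', y₁', z', w', c', d'].getD i 0, rfl, ?_⟩
    simp only [integralityEquationsAt, integralityEquations, certificateEquations,
      List.forall_mem_cons, List.forall_mem_append, evalTerms_cons, evalTerms_nil,
      List.map_cons, List.map_nil, List.prod_cons, List.prod_nil, Nat.reduceAdd,
      List.getD_cons_succ, List.getD_cons_zero]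
    push_cast
    refine ⟨by ring, by ring, by linarith, ⟨?_, by linarith, by linarith, by linarith, by linarith, by simp⟩,
      ⟨?_, by linarith, by linarith, by linarith, by linarith, by simp⟩⟩
    · field_simp; ring
    · field_simp; ring

end Terms

/-! ### Deciding equality of polynomials given by term lists -/

section PolynomialEquality

/-- The coefficient of the monomial with list of variables `m`. -/
def coeffTerms (L : List (ℤ × List ℕ)) (m : List ℕ) : ℤ :=
  ((L.filter fun t => t.2.Perm m).map Prod.fst).sum

theorem polyOfTerms_cons (t : ℤ × List ℕ) (L : List (ℤ × List ℕ)) :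
    polyOfTerms (t :: L) =
      MvPolynomial.monomial (Multiset.toFinsupp (t.2 : Multiset ℕ)) t.1 + polyOfTerms L := by
  have h : ∀ l : List ℕ, (l.map (MvPolynomial.X (R := ℤ))).prod =
      MvPolynomial.monomial (Multiset.toFinsupp (l : Multiset ℕ)) 1 := by
    intro l
    induction l with
    | nil => simp
    | cons i l ih =>
      rw [List.map_cons, List.prod_cons, ih, ← Multiset.cons_coe, ← Multiset.singleton_add, map_add,
        Multiset.toFinsupp_singleton, MvPolynomial.X, MvPolynomial.monomial_mul, mul_one]
  rw [polyOfTerms, List.map_cons, List.sum_cons, h, MvPolynomial.C_mul_monomial, mul_one, polyOfTerms]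

theorem coeff_polyOfTerms (L : List (ℤ × List ℕ)) (m : List ℕ) :
    (polyOfTerms L).coeff (Multiset.toFinsupp (m : Multiset ℕ)) = coeffTerms L m := by
  induction L with
  | nil => simp [polyOfTerms, coeffTerms]
  | cons t L ih =>
    rw [polyOfTerms_cons, MvPolynomial.coeff_add, ih, MvPolynomial.coeff_monomial]
    by_cases h : t.2.Perm m
    · have : (t.2 : Multiset ℕ) = m := Multiset.coe_eq_coe.2 h
      simp [coeffTerms, h, this]
    · have : (t.2 : Multiset ℕ) ≠ m := fun h' => h (Multiset.coe_eq_coe.1 h')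
      rw [if_neg (fun h' => this (Multiset.toFinsupp.injective h'))]
      simp [coeffTerms, h]

/-- Monomials that occur in neither list have coefficient `0` on both sides, so finitely many
comparisons decide equality. This makes it possible to search for the index of a polynomial. -/
theorem polyOfTerms_eq_iff (L L' : List (ℤ × List ℕ)) :
    polyOfTerms L = polyOfTerms L' ↔
      ∀ t ∈ L ++ L', coeffTerms L t.2 = coeffTerms L' t.2 := by
  constructor
  · intro h t _
    rw [← coeff_polyOfTerms, ← coeff_polyOfTerms, h]
  · intro h
    ext s
    obtain ⟨m, rfl⟩ : ∃ m : List ℕ, s = Multiset.toFinsupp (m : Multiset ℕ) :=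
      ⟨(Multiset.toFinsupp.symm s).toList, by simp⟩
    by_cases hm : ∃ t ∈ L ++ L', t.2.Perm m
    · obtain ⟨t, ht, hp⟩ := hm
      rw [← Multiset.coe_eq_coe.2 hp, coeff_polyOfTerms, coeff_polyOfTerms]
      exact h t ht
    · push Not at hm
      rw [coeff_polyOfTerms, coeff_polyOfTerms, coeffTerms, coeffTerms,
        List.filter_eq_nil_iff.2, List.filter_eq_nil_iff.2]
      · intro t ht; simpa using hm t (List.mem_append_right _ ht)
      · intro t ht; simpa using hm t (List.mem_append_left _ ht)

end PolynomialEquality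

/-! ### Coding the queries as single polynomials -/

section Systems

/-- The variables that occur in a list of terms. -/
def varsTerms (L : List (ℤ × List ℕ)) : List ℕ := L.flatMap Prod.snd

/-- The copy of the variable `j` of `integralityEquationsAt q` that is used for the variable `i` of
a polynomial. -/
def auxVariable (i : ℕ) (q : ℕ × ℕ) (j : ℕ) : ℕ :=
  if j = 0 then Nat.pair i 0 else Nat.pair i (Nat.pair (Nat.pair q.1 q.2) j + 1)

/-- A polynomial that has a rational zero if and only if `L` has a rational zero that is integral
at the primes in `J`. -/
def integralTerms (L : List (ℤ × List ℕ)) (J : List (ℕ × ℕ)) : List (ℤ × List ℕ) :=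
  sumSqTerms (renameTerms (fun i => Nat.pair i 0) L :: (varsTerms L).flatMap fun i =>
    J.flatMap fun q => (integralityEquationsAt q).map (renameTerms (auxVariable i q)))

theorem exists_evalTerms_integralTerms_iff (L : List (ℤ × List ℕ)) {J : List (ℕ × ℕ)}
    (hJ : ∀ q ∈ J, IsCertificateParam q.1 q.2) :
    (∃ x : ℕ → ℚ, evalTerms x (integralTerms L J) = 0) ↔
      ∃ y : ℕ → ℚ, evalTerms y L = 0 ∧ ∀ i ∈ varsTerms L, ∀ q ∈ J, ¬ q.1 ∣ (y i).den := by
  simp only [integralTerms, evalTerms_sumSqTerms_eq_zero_iff, List.forall_mem_cons,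
    evalTerms_renameTerms]
  constructor
  · rintro ⟨x, h1, h2⟩
    refine ⟨_, h1, fun i hi q hq => (exists_integralityEquationsAt_iff (hJ q hq) _).1
      ⟨x ∘ auxVariable i q, by simp [auxVariable], fun e he => ?_⟩⟩
    rw [← evalTerms_renameTerms]
    exact h2 _ (List.mem_flatMap.2 ⟨i, hi, List.mem_flatMap.2 ⟨q, hq, List.mem_map_of_mem he⟩⟩)
  · rintro ⟨y, h1, h2⟩
    have hv : ∀ (i : ℕ) (q : ℕ × ℕ), ∃ v : ℕ → ℚ, v 0 = y i ∧ (i ∈ varsTerms L → q ∈ J →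
        ∀ e ∈ integralityEquationsAt q, evalTerms v e = 0) := by
      intro i q
      by_cases h : i ∈ varsTerms L ∧ q ∈ J
      · obtain ⟨v, hv0, hv⟩ := (exists_integralityEquationsAt_iff (hJ q h.2) _).2 (h2 i h.1 q h.2)
        exact ⟨v, hv0, fun _ _ => hv⟩
      · exact ⟨fun _ => y i, rfl, fun hi hq => absurd ⟨hi, hq⟩ h⟩
    choose v hv0 hv using hv
    -- The solutions for different variables and primes can be glued because their auxiliary
    -- variables are disjoint; slot `0` is the shared original variable, and the successor in
    -- `auxVariable` keeps the others away from it.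
    let x : ℕ → ℚ := fun k => match k.unpair.2 with
      | 0 => y k.unpair.1
      | m + 1 => v k.unpair.1 m.unpair.1.unpair m.unpair.2
    have hx0 : (x ∘ fun i => Nat.pair i 0) = y := by ext i; simp [x]
    have hx : ∀ i q, x ∘ auxVariable i q = v i q := by
      intro i q; ext j
      by_cases hj : j = 0
      · subst hj; simp [x, auxVariable, hv0]
      · simp [x, auxVariable, hj]
    refine ⟨x, by rw [hx0]; exact h1, fun e he => ?_⟩
    obtain ⟨i, hi, he⟩ := List.mem_flatMap.1 he
    obtain ⟨q, hq, he⟩ := List.mem_flatMap.1 he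
    obtain ⟨e', he', rfl⟩ := List.mem_map.1 he
    rw [evalTerms_renameTerms, hx]
    exact hv i q hi hq e' he'

/-- A polynomial that has a zero if and only if the point `a / m` is a zero of `L`. -/
def pointTerms (L : List (ℤ × List ℕ)) (m : ℕ) (a : List ℤ) : List (ℤ × List ℕ) :=
  sumSqTerms (L :: (varsTerms L).map fun i => [((m : ℤ), [i]), (-(a.getD i 0), [])])

/-- This turns the verification of an explicit point into a question about rational solvability, so
that positive and negative witnesses are both tested by one oracle query. -/
theorem evalTerms_pointTerms_eq_zero_iff (L : List (ℤ × List ℕ)) (m : ℕ) (a : List ℤ) (x : ℕ → ℚ) :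
    evalTerms x (pointTerms L m a) = 0 ↔
      evalTerms x L = 0 ∧ ∀ i ∈ varsTerms L, (m : ℚ) * x i = a.getD i 0 := by
  simp only [pointTerms, evalTerms_sumSqTerms_eq_zero_iff, List.forall_mem_cons, List.forall_mem_map]
  simp [add_neg_eq_zero]

/-- The equation that says that the variable `0` is one more than a sum of four squares. -/
def positivityEquation : List (ℤ × List ℕ) :=
  [(1, [0]), (-1, []), (-1, [1, 1]), (-1, [2, 2]), (-1, [3, 3]), (-1, [4, 4])]

/-- The homogenization of a polynomial; the variable `0` is the new variable. -/
def homogeneousTerms (L : List (ℤ × List ℕ)) : List (ℤ × List ℕ) :=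
  L.map fun t => (t.1, t.2.map (· + 5) ++ List.replicate ((varsTerms L).length - t.2.length) 0)

theorem evalTerms_homogeneousTerms {K : Type*} [Field K] (x : ℕ → K) (h0 : x 0 ≠ 0)
    (L : List (ℤ × List ℕ)) :
    evalTerms x (homogeneousTerms L) =
      x 0 ^ (varsTerms L).length * evalTerms (fun i => x (i + 5) / x 0) L := by
  rw [homogeneousTerms]
  -- The number of all occurrences of variables in `L` is a crude bound for the degree.
  have hlen : ∀ t ∈ L, t.2.length ≤ (varsTerms L).length := by
    intro t ht
    rw [varsTerms, List.length_flatMap]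
    exact List.single_le_sum (by simp) _ (List.mem_map_of_mem (f := fun t => t.2.length) ht)
  generalize (varsTerms L).length = N at hlen
  have hprod : ∀ l : List ℕ, (l.map fun i => x (i + 5)).prod =
      x 0 ^ l.length * (l.map fun i => x (i + 5) / x 0).prod := by
    intro l
    induction l with
    | nil => simp
    | cons i l ih =>
      simp only [List.map_cons, List.prod_cons, ih, List.length_cons, pow_succ]
      field_simp
  induction L with
  | nil => simp
  | cons t L ih =>
    rw [List.map_cons, evalTerms_cons, evalTerms_cons, ih fun t ht => hlen t (List.mem_cons_of_mem _ ht)]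
    have := hprod t.2
    simp only [List.map_append, List.map_map, List.prod_append, List.map_replicate,
      List.prod_replicate, Function.comp_def, this]
    have hN := Nat.sub_add_cancel (hlen t List.mem_cons_self)
    rw [mul_add]
    congr 1
    rw [← hN, pow_add, Nat.add_sub_cancel]
    ring

/-- A polynomial that has a zero in a subring of `ℚ` if and only if `L` has a rational zero. -/
def rationalTerms (L : List (ℤ × List ℕ)) : List (ℤ × List ℕ) :=
  sumSqTerms [positivityEquation, homogeneousTerms L]

/-- The variable `0` plays the common denominator. Being one more than a sum of squares it is
nonzero in any subring of `ℚ`; conversely Lagrange's theorem writes every positive integer in this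
form, so clearing denominators gives a zero already in `ℤ`. -/
theorem exists_evalTerms_rationalTerms_iff (S : Subring ℚ) (L : List (ℤ × List ℕ)) :
    (∃ x : ℕ → S, evalTerms x (rationalTerms L) = 0) ↔ ∃ y : ℕ → ℚ, evalTerms y L = 0 := by
  have hcoe : ∀ x : ℕ → S, evalTerms x (rationalTerms L) = 0 ↔
      evalTerms (S.subtype ∘ x) (rationalTerms L) = 0 := by
    intro x
    rw [← map_evalTerms, map_eq_zero_iff _ S.subtype_injective]
  have hpos : ∀ x : ℕ → ℚ, evalTerms x positivityEquation = 0 ↔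
      x 0 = 1 + (x 1 ^ 2 + x 2 ^ 2 + x 3 ^ 2 + x 4 ^ 2) := by
    intro x
    simp only [positivityEquation, evalTerms_cons, evalTerms_nil, List.map_cons, List.map_nil,
      List.prod_cons, List.prod_nil]
    push_cast
    constructor <;> intro h <;> linarith
  simp only [hcoe]
  simp only [rationalTerms, evalTerms_sumSqTerms_eq_zero_iff, List.forall_mem_cons, hpos]
  constructor
  · rintro ⟨x, h1, h2, -⟩
    have h0 : (S.subtype ∘ x) 0 ≠ 0 := by
      have : 0 < (S.subtype ∘ x) 0 := by rw [h1]; positivity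
      exact this.ne'
    rw [evalTerms_homogeneousTerms _ h0, mul_eq_zero] at h2
    exact ⟨_, h2.resolve_left (pow_ne_zero _ h0)⟩
  · rintro ⟨y, hy⟩
    set d : ℕ := ((varsTerms L).map fun i => (y i).den).prod with hd
    have hd0 : d ≠ 0 := by
      rw [hd, ne_eq, List.prod_eq_zero_iff]
      simp
    have hint : ∀ i ∈ varsTerms L, ∃ z : ℤ, (z : ℚ) = y i * d := by
      intro i hi
      obtain ⟨k, hk⟩ := List.dvd_prod (List.mem_map_of_mem (f := fun i => (y i).den) hi)
      refine ⟨(y i).num * k, ?_⟩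
      rw [hd, hk]; push_cast; rw [← mul_assoc, Rat.mul_den_eq_num]
    have hint' : ∀ i, ∃ z : ℤ, i ∈ varsTerms L → (z : ℚ) = y i * d := by
      intro i
      by_cases hi : i ∈ varsTerms L
      · obtain ⟨z, hz⟩ := hint i hi; exact ⟨z, fun _ => hz⟩
      · exact ⟨0, fun h => absurd h hi⟩
    choose z hz using hint'
    obtain ⟨a, b, c, e, habce⟩ := Nat.sum_four_squares (d - 1)
    let w : ℕ → ℤ := fun i => match i with
      | 0 => d
      | 1 => a
      | 2 => b
      | 3 => c
      | 4 => e
      | i + 5 => z i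
    have hwS : (S.subtype ∘ fun i => (w i : S)) = fun i => (w i : ℚ) := by ext i; simp
    refine ⟨fun i => (w i : S), ?_, ?_, by simp⟩ <;> rw [hwS]
    · have : d = 1 + (a ^ 2 + b ^ 2 + c ^ 2 + e ^ 2) := by omega
      simp only [w, Int.cast_natCast]
      rw [this]; push_cast; ring
    · have hdQ : (d : ℚ) ≠ 0 := by exact_mod_cast hd0
      rw [evalTerms_homogeneousTerms]
      · rw [← mul_zero ((w 0 : ℚ) ^ (varsTerms L).length), ← hy]
        congr 1
        refine evalTerms_congr fun i hi => ?_
        simp only [w, Int.cast_natCast]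
        rw [hz i hi]; field_simp
      · simpa [w] using hd0

end Systems

/-! ### The rings `R_W` through denominators -/

section RingOf

theorem one_div_mem_ringOf (W : PrimeSets) (n : ℕ) (h0 : n ≠ 0)
    (h : ∀ p : Nat.Primes, (p : ℕ) ∣ n → W p = true) : 1 / (n : ℚ) ∈ ringOf W := by
  induction n using induction_on_primes with
  | zero => exact absurd rfl h0
  | one => simp
  | prime_mul p a hp ih =>
    have ha : a ≠ 0 := right_ne_zero_of_mul h0
    rw [Nat.cast_mul, ← one_div_mul_one_div]
    refine mul_mem ?_ (ih ha fun q hq => h q (hq.mul_left p))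
    exact Subring.subset_closure ⟨⟨p, hp⟩, h ⟨p, hp⟩ (dvd_mul_right p a), by simp⟩

theorem mem_ringOf_iff {W : PrimeSets} {x : ℚ} :
    x ∈ ringOf W ↔ ∀ p : Nat.Primes, (p : ℕ) ∣ x.den → W p = true := by
  constructor
  · intro hx
    have hone : ∀ p : Nat.Primes, ¬ (p : ℕ) ∣ 1 := fun p => p.2.not_dvd_one
    induction hx using Subring.closure_induction with
    | mem x hx =>
      obtain ⟨q, hq, rfl⟩ := hx
      intro p hp
      have : (1 / ((q : ℕ) : ℚ)).den = q := by
        rw [one_div, Rat.inv_natCast_den_of_pos q.2.pos]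
      rw [this] at hp
      rwa [Subtype.ext ((Nat.prime_dvd_prime_iff_eq p.2 q.2).1 hp)]
    | zero => intro p hp; exact absurd hp (by simpa using hone p)
    | one => intro p hp; exact absurd hp (by simpa using hone p)
    | add x y _ _ hx hy =>
      intro p hp
      exact (p.2.dvd_mul.1 (hp.trans (Rat.add_den_dvd x y))).elim (hx p) (hy p)
    | neg x _ hx => intro p hp; exact hx p (by simpa using hp)
    | mul x y _ _ hx hy =>
      intro p hp
      exact (p.2.dvd_mul.1 (hp.trans (Rat.mul_den_dvd x y))).elim (hx p) (hy p)
  · intro h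
    rw [← Rat.num_div_den x, div_eq_mul_one_div]
    exact mul_mem (intCast_mem _ _) (one_div_mem_ringOf W _ x.den_ne_zero h)

/-- Variables that do not occur in `L` may be reset to `0`. -/
theorem exists_evalTerms_subring_iff (S : Subring ℚ) (L : List (ℤ × List ℕ)) :
    (∃ x : ℕ → S, evalTerms x L = 0) ↔
      ∃ y : ℕ → ℚ, evalTerms y L = 0 ∧ ∀ i ∈ varsTerms L, y i ∈ S := by
  classical
  constructor
  · rintro ⟨x, hx⟩
    refine ⟨S.subtype ∘ x, by rw [← map_evalTerms, hx, map_zero], fun i _ => (x i).2⟩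
  · rintro ⟨y, hy, hyS⟩
    refine ⟨fun i => if h : y i ∈ S then ⟨y i, h⟩ else 0, ?_⟩
    apply S.subtype_injective
    rw [map_evalTerms, map_zero, ← hy]
    refine evalTerms_congr fun i hi => ?_
    simp [hyS i hi]

theorem polyOfTerms_mem_HTP_iff (R : Type*) [CommRing R] (L : List (ℤ × List ℕ)) :
    polyOfTerms L ∈ HTP R ↔ ∃ x : ℕ → R, evalTerms x L = 0 := by
  simp only [HTP, Set.mem_ofPred_eq, aeval_polyOfTerms]

theorem polyOfTerms_mem_HTP_ringOf_iff (W : PrimeSets) (L : List (ℤ × List ℕ)) :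
    polyOfTerms L ∈ HTP (ringOf W) ↔ ∃ y : ℕ → ℚ, evalTerms y L = 0 ∧
      ∀ i ∈ varsTerms L, ∀ p : Nat.Primes, (p : ℕ) ∣ (y i).den → W p = true := by
  rw [polyOfTerms_mem_HTP_iff, exists_evalTerms_subring_iff]
  simp only [mem_ringOf_iff]

end RingOf

/-! ### Computability of the constructions -/

section Primrec

open Primrec

theorem Int.encode_natCast (n : ℕ) : Encodable.encode (n : ℤ) = 2 * n := rfl

theorem Int.encode_negSucc (n : ℕ) : Encodable.encode (Int.negSucc n) = 2 * n + 1 := rfl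

theorem Primrec.int_natCast : Primrec (fun n : ℕ => (n : ℤ)) :=
  encode_iff.1 (nat_double.of_eq fun _ => rfl)

theorem Primrec.int_toNat : Primrec Int.toNat := by
  refine (Primrec.cond (nat_bodd.comp .encode) (const 0) (nat_div2.comp .encode)).of_eq fun z => ?_
  cases z with
  | ofNat n => simp [Int.encode_natCast, Nat.div2_val]
  | negSucc n => simp [Int.encode_negSucc]

theorem Primrec.int_toNat_neg : Primrec fun z : ℤ => (-z).toNat := by
  refine (Primrec.cond (nat_bodd.comp .encode) (Primrec.succ.comp (nat_div2.comp .encode))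
    (const 0)).of_eq fun z => ?_
  cases z with
  | ofNat n => simp [Int.encode_natCast]
  | negSucc n => simp [Int.encode_negSucc, Nat.div2_val]

/-- Integer negation, addition and multiplication reduce to this one through `z = z.toNat -
(-z).toNat`. -/
theorem Primrec.int_sub_natCast : Primrec₂ fun a b : ℕ => (a : ℤ) - b := by
  refine encode_iff.1 ((Primrec.ite (nat_le.comp snd fst) (nat_double.comp (nat_sub.comp fst snd))
    (nat_double_succ.comp (nat_sub.comp (nat_sub.comp snd fst) (const 1)))).of_eq fun p => ?_)
  change _ = Encodable.encode ((p.1 : ℤ) - p.2)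
  split_ifs with h
  · rw [← Nat.cast_sub h]; rfl
  · have : (p.1 : ℤ) - p.2 = Int.negSucc (p.2 - p.1 - 1) := by omega
    rw [this]; rfl

theorem Primrec.int_neg : Primrec fun z : ℤ => -z :=
  (int_sub_natCast.comp int_toNat_neg int_toNat).of_eq fun z => by omega

theorem Primrec.int_add : Primrec₂ fun a b : ℤ => a + b :=
  (int_sub_natCast.comp
    (nat_add.comp (int_toNat.comp fst) (int_toNat.comp snd))
    (nat_add.comp (int_toNat_neg.comp fst) (int_toNat_neg.comp snd))).of_eq fun p => by
      push_cast; omega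

theorem Primrec.int_mul : Primrec₂ fun a b : ℤ => a * b :=
  (int_sub_natCast.comp
    (nat_add.comp (nat_mul.comp (int_toNat.comp fst) (int_toNat.comp snd))
      (nat_mul.comp (int_toNat_neg.comp fst) (int_toNat_neg.comp snd)))
    (nat_add.comp (nat_mul.comp (int_toNat.comp fst) (int_toNat_neg.comp snd))
      (nat_mul.comp (int_toNat_neg.comp fst) (int_toNat.comp snd)))).of_eq fun p => by
      have h1 := Int.toNat_sub_toNat_neg p.1
      have h2 := Int.toNat_sub_toNat_neg p.2
      push_cast
      conv_rhs => rw [← h1, ← h2]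
      ring

theorem Primrec.list_sum_int {α : Type*} [Primcodable α] {f : α → List ℤ} (hf : Primrec f) :
    Primrec fun a => (f a).sum :=
  (list_foldr hf (const 0) (int_add.comp (fst.comp snd) (snd.comp snd)).to₂).of_eq fun a => by
    rw [List.sum]

theorem Primrec.list_prod_nat {α : Type*} [Primcodable α] {f : α → List ℕ} (hf : Primrec f) :
    Primrec fun a => (f a).prod :=
  (list_foldr hf (const 1) (nat_mul.comp (fst.comp snd) (snd.comp snd)).to₂).of_eq fun a => by
    rw [List.prod]

/-- Multiplicities need comparing only at entries of the two lists, which makes the quantifier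
bounded. -/
theorem PrimrecRel.list_perm : PrimrecRel fun l l' : List ℕ => l.Perm l' := by
  have hcount : Primrec₂ fun (l : List ℕ) (a : ℕ) => l.count a :=
    (list_length.comp (PrimrecRel.listFilter (Primrec.eq (α := ℕ)))).of_eq fun p => by
      rw [← List.countP_eq_length_filter]; rfl
  have hrel : PrimrecRel fun (a : ℕ) (q : List ℕ × List ℕ) => q.1.count a = q.2.count a :=
    Primrec.eq.comp (hcount.comp (fst.comp snd) fst) (hcount.comp (snd.comp snd) fst)
  refine (hrel.forall_mem_list.comp list_append .id).of_eq fun q => ?_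
  change (∀ a ∈ q.1 ++ q.2, q.1.count a = q.2.count a) ↔ q.1.Perm q.2
  rw [List.perm_iff_count]
  refine ⟨fun h a => ?_, fun h a _ => h a⟩
  by_cases ha : a ∈ q.1 ++ q.2
  · exact h a ha
  · rw [List.mem_append, not_or] at ha
    rw [List.count_eq_zero_of_not_mem ha.1, List.count_eq_zero_of_not_mem ha.2]

theorem primrec₂_coeffTerms : Primrec₂ coeffTerms := by
  have hrel : PrimrecRel fun (t : ℤ × List ℕ) (m : List ℕ) => t.2.Perm m :=
    PrimrecRel.list_perm.comp (snd.comp fst) snd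
  exact list_sum_int (list_map hrel.listFilter (fst.comp snd).to₂)

theorem primrecRel_polyOfTerms_eq :
    PrimrecRel fun L L' : List (ℤ × List ℕ) => polyOfTerms L = polyOfTerms L' := by
  have hrel : PrimrecRel fun (t : ℤ × List ℕ) (q : List (ℤ × List ℕ) × List (ℤ × List ℕ)) =>
      coeffTerms q.1 t.2 = coeffTerms q.2 t.2 :=
    Primrec.eq.comp (primrec₂_coeffTerms.comp (fst.comp snd) (snd.comp fst))
      (primrec₂_coeffTerms.comp (snd.comp snd) (snd.comp fst))
  exact (hrel.forall_mem_list.comp list_append .id).of_eq fun q => (polyOfTerms_eq_iff _ _).symm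

theorem primrec₂_mulTerms : Primrec₂ mulTerms := by
  refine list_flatMap fst (Primrec₂.mk ?_)
  refine list_map (snd.comp fst) (Primrec₂.mk ?_)
  exact Primrec.pair (int_mul.comp (fst.comp (snd.comp fst)) (fst.comp snd))
    (list_append.comp (snd.comp (snd.comp fst)) (snd.comp snd))

theorem primrec_sumSqTerms : Primrec sumSqTerms :=
  list_flatMap .id (primrec₂_mulTerms.comp snd snd).to₂

theorem primrec_renameTerms {α : Type*} [Primcodable α] {ρ : α → ℕ → ℕ} {f : α → List (ℤ × List ℕ)}
    (hρ : Primrec₂ ρ) (hf : Primrec f) : Primrec fun a => renameTerms (ρ a) (f a) := by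
  refine list_map hf (Primrec₂.mk ?_)
  refine Primrec.pair (fst.comp snd) ?_
  exact list_map (snd.comp snd) (Primrec₂.mk (hρ.comp (fst.comp fst) snd))

theorem primrec_varsTerms : Primrec varsTerms := list_flatMap .id (snd.comp snd).to₂

theorem primrec_integralityEquationsAt : Primrec integralityEquationsAt := by
  have hparam : ∀ {f : ℕ × ℕ → ℕ} (k : ℕ), Primrec f →
      Primrec fun q => [((1 : ℤ), [k]), (-(f q : ℤ), [])] := fun k hf =>
    list_cons.comp (const _) (list_cons.comp
      (Primrec.pair (int_neg.comp (int_natCast.comp hf)) (const [])) (const []))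
  exact list_cons.comp (hparam 1 fst) (list_cons.comp (hparam 2 snd) (const _))

theorem primrec_auxVariable : Primrec₂ fun (e : ℕ × ℕ × ℕ) (j : ℕ) => auxVariable e.1 e.2 j :=
  Primrec.ite (Primrec.eq.comp snd (const 0)) (Primrec₂.natPair.comp (fst.comp fst) (const 0))
    (Primrec₂.natPair.comp (fst.comp fst) (Primrec.succ.comp (Primrec₂.natPair.comp
      (Primrec₂.natPair.comp (fst.comp (snd.comp fst)) (snd.comp (snd.comp fst))) snd)))

theorem primrec_integralityEquationsAt_rename : Primrec fun e : ℕ × ℕ × ℕ =>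
    (integralityEquationsAt e.2).map (renameTerms (auxVariable e.1 e.2)) := by
  refine list_map (primrec_integralityEquationsAt.comp snd) (Primrec₂.mk ?_)
  have h : Primrec₂ fun (a : (ℕ × ℕ × ℕ) × List (ℤ × List ℕ)) (j : ℕ) =>
      auxVariable a.1.1 a.1.2 j := primrec_auxVariable.comp (fst.comp fst) snd
  exact primrec_renameTerms h snd

theorem primrec₂_integralTerms : Primrec₂ integralTerms := by
  have hpair : Primrec₂ fun (_ : List (ℤ × List ℕ) × List (ℕ × ℕ)) (i : ℕ) => Nat.pair i 0 :=
    Primrec₂.natPair.comp snd (const 0)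
  have haux : Primrec fun a : List (ℤ × List ℕ) × List (ℕ × ℕ) => (varsTerms a.1).flatMap fun i =>
      a.2.flatMap fun q => (integralityEquationsAt q).map (renameTerms (auxVariable i q)) := by
    refine list_flatMap (primrec_varsTerms.comp fst) (Primrec₂.mk ?_)
    refine list_flatMap (snd.comp fst) (Primrec₂.mk ?_)
    exact primrec_integralityEquationsAt_rename.comp (Primrec.pair (snd.comp fst) snd)
  exact primrec_sumSqTerms.comp (list_cons.comp (primrec_renameTerms hpair fst) haux)

theorem primrec_pointTerms : Primrec fun e : List (ℤ × List ℕ) × ℕ × List ℤ =>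
    pointTerms e.1 e.2.1 e.2.2 := by
  refine primrec_sumSqTerms.comp (list_cons.comp fst ?_)
  refine list_map (primrec_varsTerms.comp fst) (Primrec₂.mk ?_)
  refine list_cons.comp (Primrec.pair (int_natCast.comp (fst.comp (snd.comp fst)))
    (list_cons.comp snd (const []))) (list_cons.comp (Primrec.pair (int_neg.comp ?_) (const []))
      (const []))
  exact (list_getD 0).comp (snd.comp (snd.comp fst)) snd

theorem primrec_homogeneousTerms : Primrec homogeneousTerms := by
  have hrep : Primrec fun n : ℕ => List.replicate n 0 :=
    (list_map list_range (const 0).to₂).of_eq fun n => by simp [List.map_const']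
  refine list_map .id (Primrec₂.mk ?_)
  refine Primrec.pair (fst.comp snd) (list_append.comp ?_ (hrep.comp (nat_sub.comp
    (list_length.comp (primrec_varsTerms.comp fst)) (list_length.comp (snd.comp snd)))))
  exact list_map (snd.comp snd) (Primrec₂.mk (nat_add.comp snd (const 5)))

theorem primrec_rationalTerms : Primrec rationalTerms :=
  primrec_sumSqTerms.comp (list_cons.comp (const _)
    (list_cons.comp primrec_homogeneousTerms (const [])))

theorem primrecPred_prime : PrimrecPred Nat.Prime := by
  have hrel : PrimrecRel fun m p : ℕ => m < 2 ∨ p % m ≠ 0 :=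
    (nat_lt.comp fst (const 2)).or (Primrec.eq.comp (nat_mod.comp snd fst) (const 0)).not
  refine ((nat_le.comp (const 2) .id).and (hrel.forall_lt.comp .id .id)).of_eq fun p => ?_
  rw [Nat.prime_def_lt']
  simp only [id, Nat.dvd_iff_mod_eq_zero, ← not_le]
  exact and_congr Iff.rfl ⟨fun h m h2 hm => (h m hm).resolve_left (not_not.2 h2),
    fun h m hm => (em (2 ≤ m)).elim (fun h2 => Or.inr (h m h2 hm)) Or.inl⟩

theorem primrec_count_prime : Primrec (Nat.count Nat.Prime) := by
  refine (list_length.comp ((listFilter primrecPred_prime).comp list_range)).of_eq fun n => ?_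
  rw [← List.countP_eq_length_filter]; rfl

theorem primrecRel_isCertificateParam : PrimrecRel IsCertificateParam := by
  have hrel : PrimrecRel fun (x : ℕ) (q : ℕ × ℕ) => x * x % q.1 ≠ q.2 % q.1 :=
    (Primrec.eq.comp (nat_mod.comp (nat_mul.comp fst fst) (fst.comp snd))
      (nat_mod.comp (snd.comp snd) (fst.comp snd))).not
  have hall : PrimrecPred fun q : ℕ × ℕ => ∀ x < q.1, x * x % q.1 ≠ q.2 % q.1 :=
    (hrel.forall_mem_list.comp (list_range.comp fst) .id).of_eq fun q => by simp
  exact (primrecPred_prime.comp fst).and ((Primrec.eq.comp (nat_mod.comp snd (const 8)) (const 5)).and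
    ((Primrec.eq.comp fst (const 2)).or hall))

theorem computable_nth_prime : Computable (Nat.nth Nat.Prime) := by
  have hrel : PrimrecRel fun i p : ℕ => p.Prime ∧ Nat.count Nat.Prime p = i :=
    (primrecPred_prime.comp snd).and (Primrec.eq.comp (primrec_count_prime.comp snd) fst)
  have hc : Computable₂ fun i p : ℕ => decide (p.Prime ∧ Nat.count Nat.Prime p = i) :=
    hrel.decide.to_comp
  refine (Partrec.rfind hc.partrec₂).of_eq_tot fun i => ?_
  have hcount := Nat.count_nth_of_infinite Nat.infinite_setOfPred_prime i
  rw [Nat.mem_rfind]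
  refine ⟨?_, fun {m} hm => ?_⟩
  · simp [Nat.prime_nth_prime, hcount]
  · have : ¬ (m.Prime ∧ Nat.count Nat.Prime m = i) := by
      rintro ⟨h1, rfl⟩
      rw [Nat.nth_count h1] at hm
      exact lt_irrefl _ hm
    simpa using this

/-- Unbounded search for the index: equality of term lists as polynomials is decidable, and
surjectivity of `ν` makes the search halt. -/
theorem IsComputableNumbering.computable_symm {ν : ℕ ≃ MvPolynomial ℕ ℤ}
    (hν : IsComputableNumbering ν) : Computable fun L => ν.symm (polyOfTerms L) := by
  classical
  obtain ⟨r, hr, hνr⟩ := hν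
  have hc : Computable₂ fun (L : List (ℤ × List ℕ)) (n : ℕ) =>
      decide (polyOfTerms L = polyOfTerms (r n)) :=
    primrecRel_polyOfTerms_eq.decide.to_comp.comp Computable.fst (hr.comp Computable.snd)
  refine (Partrec.rfind hc.partrec₂).of_eq_tot fun L => ?_
  rw [Nat.mem_rfind]
  refine ⟨?_, fun {m} hm => ?_⟩
  · simp [← hνr]
  · have : polyOfTerms L ≠ polyOfTerms (r m) := by
      intro h
      rw [h, ← hνr, Equiv.symm_apply_apply] at hm
      exact lt_irrefl _ hm
    simpa using this

end Primrec

/-! ### Oracle programs and searches -/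

section Oracle

theorem Nat.Partrec.exists_oracleCode {f : ℕ →. ℕ} (hf : Nat.Partrec f) :
    ∃ Φ : OracleCode, ∀ g, Φ.eval g = f := by
  induction hf with
  | zero => exact ⟨.zero, fun _ => rfl⟩
  | succ => exact ⟨.succ, fun _ => rfl⟩
  | left => exact ⟨.left, fun _ => rfl⟩
  | right => exact ⟨.right, fun _ => rfl⟩
  | pair _ _ ha hb =>
    obtain ⟨a, ha⟩ := ha
    obtain ⟨b, hb⟩ := hb
    exact ⟨.pair a b, fun g => by rw [OracleCode.eval, ha, hb]⟩
  | comp _ _ ha hb =>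
    obtain ⟨a, ha⟩ := ha
    obtain ⟨b, hb⟩ := hb
    exact ⟨.comp a b, fun g => by rw [OracleCode.eval, ha, hb]⟩
  | prec _ _ ha hb =>
    obtain ⟨a, ha⟩ := ha
    obtain ⟨b, hb⟩ := hb
    exact ⟨.prec a b, fun g => by rw [OracleCode.eval, ha, hb]⟩
  | rfind _ ha =>
    obtain ⟨a, ha⟩ := ha
    exact ⟨.rfind a, fun g => by rw [OracleCode.eval, ha]⟩

theorem Computable.exists_oracleCode {α β : Type*} [Primcodable α] [Primcodable β] {f : α → β}
    (hf : Computable f) :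
    ∃ Φ : OracleCode, ∀ g a, Φ.eval g (Encodable.encode a) = Part.some (Encodable.encode (f a)) := by
  obtain ⟨Φ, hΦ⟩ := Nat.Partrec.exists_oracleCode hf
  exact ⟨Φ, fun g a => by rw [hΦ]; simp⟩

theorem OracleCode.eval_pair_of_eq {a b : OracleCode} {g : ℕ →. ℕ} {n x y : ℕ}
    (ha : a.eval g n = Part.some x) (hb : b.eval g n = Part.some y) :
    (OracleCode.pair a b).eval g n = Part.some (Nat.pair x y) := by
  simp [OracleCode.eval, ha, hb, Seq.seq]

theorem OracleCode.eval_comp_of_eq {a b : OracleCode} {g : ℕ →. ℕ} {n x : ℕ} {y : Part ℕ}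
    (hb : b.eval g n = Part.some x) (ha : a.eval g x = y) : (OracleCode.comp a b).eval g n = y := by
  simp only [OracleCode.eval, hb]
  exact (Part.bind_some _ _).trans ha

theorem OracleCode.eval_left (g : ℕ →. ℕ) (m n : ℕ) :
    OracleCode.left.eval g (Nat.pair m n) = Part.some m := by
  simp [OracleCode.eval]

theorem OracleCode.eval_right (g : ℕ →. ℕ) (m n : ℕ) :
    OracleCode.right.eval g (Nat.pair m n) = Part.some n := by
  simp [OracleCode.eval]

theorem OracleCode.eval_prec_succ_of_eq {a b : OracleCode} {g : ℕ →. ℕ} {x n i : ℕ} {y : Part ℕ}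
    (hi : (OracleCode.prec a b).eval g (Nat.pair x n) = Part.some i)
    (hb : b.eval g (Nat.pair x (Nat.pair n i)) = y) :
    (OracleCode.prec a b).eval g (Nat.pair x (n + 1)) = y := by
  simp only [OracleCode.eval, Nat.unpair_pair] at hi ⊢
  rw [hi]
  exact (Part.bind_some _ _).trans hb

/-- Some oracle program computes the initial segments of its oracle. -/
theorem exists_oracleCode_segment : ∃ Φ : OracleCode, ∀ (G : ℕ →. ℕ) (g : ℕ → ℕ),
    (∀ k, G k = Part.some (g k)) → ∀ n x : ℕ,
    Φ.eval G (Nat.pair x n) = Part.some (Encodable.encode ((List.range n).map g)) := by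
  have happ : Computable fun q : List ℕ × ℕ => q.1 ++ [q.2] := Primrec.list_concat.to_comp
  obtain ⟨A, hA⟩ := happ.exists_oracleCode
  obtain ⟨Z, hZ⟩ := (Computable.const (α := ℕ) ([] : List ℕ)).exists_oracleCode
  let step : OracleCode := .comp A (.pair (.comp .right .right) (.comp .oracle (.comp .left .right)))
  refine ⟨.prec Z step, fun G g hG n x => ?_⟩
  induction n with
  | zero =>
    simp only [OracleCode.eval, Nat.unpair_pair]
    exact hZ _ x
  | succ n ih =>
    refine OracleCode.eval_prec_succ_of_eq ih (OracleCode.eval_comp_of_eq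
      (x := Encodable.encode (((List.range n).map g), g n))
      (OracleCode.eval_pair_of_eq (OracleCode.eval_comp_of_eq (OracleCode.eval_right _ _ _)
        (OracleCode.eval_right _ _ _)) (OracleCode.eval_comp_of_eq (OracleCode.eval_comp_of_eq
          (OracleCode.eval_right _ _ _) (OracleCode.eval_left _ _ _)) (hG n))) ((hA _ _).trans ?_))
    rw [List.range_succ, List.map_append]
    rfl

theorem OracleCode.eval_rfind_of_eq {a : OracleCode} {G : ℕ →. ℕ} {n k : ℕ} {f : ℕ → ℕ}
    (ha : ∀ k, a.eval G (Nat.pair n k) = Part.some (f k)) (hk : f k = 0)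
    (hmin : ∀ m < k, f m ≠ 0) : (OracleCode.rfind a).eval G n = Part.some k := by
  simp only [OracleCode.eval, ha]
  refine Part.eq_some_iff.2 (Nat.mem_rfind.2 ?_)
  exact ⟨by simp [hk], fun {m} hm => by simp [hmin m hm]⟩

/-- A search for a witness that passes a computable test, where the test is allowed to use an
initial segment of the oracle, is carried out by an oracle program. -/
theorem exists_oracleCode_search {ω : Type*} [Primcodable ω] {T : ℕ × ω × List ℕ → Bool}
    (hT : Computable T) {out : ω → ℕ} (hout : Computable out) :
    ∃ Φ : OracleCode, ∀ (G : ℕ →. ℕ) (g : ℕ → ℕ), (∀ k, G k = Part.some (g k)) → ∀ n v : ℕ,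
      (∃ w N, T (n, w, (List.range N).map g) = true) →
      (∀ w N, T (n, w, (List.range N).map g) = true → out w = v) →
      Φ.eval G n = Part.some v := by
  obtain ⟨S, hS⟩ := exists_oracleCode_segment
  -- The minimization looks for the value `0`; a code that does not decode, or a failed test, yields
  -- `1`.
  have htest : Computable fun q : (ℕ × ℕ × ℕ) × List ℕ =>
      ((Encodable.decode (α := ω) q.1.2.1).bind fun w =>
        bif T (q.1.1, w, q.2) then some 0 else none).getD 1 := by
    have harg : Computable fun x : ((ℕ × ℕ × ℕ) × List ℕ) × ω => (x.1.1.1, x.2, x.1.2) :=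
      ((Computable.fst.comp Computable.fst).comp Computable.fst).pair
        (Computable.snd.pair (Computable.snd.comp Computable.fst))
    have hcond : Computable₂ fun (q : (ℕ × ℕ × ℕ) × List ℕ) (w : ω) =>
        bif T (q.1.1, w, q.2) then some 0 else (none : Option ℕ) :=
      Computable.cond (hT.comp harg) (Computable.const _) (Computable.const _)
    have hdec : Computable fun q : (ℕ × ℕ × ℕ) × List ℕ => Encodable.decode (α := ω) q.1.2.1 :=
      Computable.decode.comp (Computable.fst.comp (Computable.snd.comp Computable.fst))
    exact Computable.option_getD (Computable.option_bind hdec hcond) (Computable.const 1)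
  obtain ⟨H, hH⟩ := htest.exists_oracleCode
  have hres : Computable fun k : ℕ × ℕ => ((Encodable.decode (α := ω) k.1).map out).getD 0 := by
    have hmap : Computable₂ fun (_ : ℕ × ℕ) (w : ω) => out w := hout.comp Computable.snd
    have hdec : Computable fun k : ℕ × ℕ => Encodable.decode (α := ω) k.1 :=
      Computable.decode.comp Computable.fst
    exact Computable.option_getD (Computable.option_map hdec hmap) (Computable.const 0)
  obtain ⟨O, hO⟩ := hres.exists_oracleCode
  let body : OracleCode := .comp H (.pair (.pair .left .right) (.comp S .right))
  refine ⟨.comp O (.rfind body), fun G g hG n v hex hall => ?_⟩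
  set test : ℕ → ℕ := fun k => ((Encodable.decode (α := ω) k.unpair.1).bind fun w =>
    bif T (n, w, (List.range k.unpair.2).map g) then some 0 else none).getD 1 with htest_def
  have hbody : ∀ k, body.eval G (Nat.pair n k) = Part.some (test k) := by
    intro k
    obtain ⟨i, j, rfl⟩ : ∃ i j, Nat.pair i j = k := ⟨_, _, Nat.pair_unpair k⟩
    refine OracleCode.eval_comp_of_eq (x := Encodable.encode ((n, i, j), (List.range j).map g))
      (OracleCode.eval_pair_of_eq (OracleCode.eval_pair_of_eq (OracleCode.eval_left _ _ _)
        (OracleCode.eval_right _ _ _)) (OracleCode.eval_comp_of_eq (OracleCode.eval_right _ _ _)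
          (hS G g hG j i))) ((hH _ _).trans ?_)
    simp only [htest_def, Nat.unpair_pair]
    rfl
  have htest0 : ∀ k, test k = 0 ↔ ∃ w, Encodable.decode (α := ω) k.unpair.1 = some w ∧
      T (n, w, (List.range k.unpair.2).map g) = true := by
    intro k
    simp only [htest_def]
    cases hd : Encodable.decode (α := ω) k.unpair.1 with
    | none => simp
    | some w =>
      cases hTw : T (n, w, (List.range k.unpair.2).map g) <;> simp [hTw]
  obtain ⟨w, N, hw⟩ := hex
  have hdom : ∃ k, test k = 0 :=
    ⟨Nat.pair (Encodable.encode w) N, (htest0 _).2 ⟨w, by simp, by simpa using hw⟩⟩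
  -- The search may stop at another witness than the given one; this is harmless, because all
  -- accepted witnesses have the same output.
  obtain ⟨w', hd, hw'⟩ := (htest0 _).1 (Nat.find_spec hdom)
  refine OracleCode.eval_comp_of_eq (OracleCode.eval_rfind_of_eq hbody (Nat.find_spec hdom)
    fun m hm => Nat.find_min hdom hm) ?_
  have hk : Nat.find hdom = Encodable.encode (Nat.find hdom).unpair := by
    rw [Encodable.encode_prod_val]; simp
  rw [hk]
  refine (hO _ _).trans ?_
  rw [hd]
  simp [hall _ _ hw']

theorem turingReducible_charFun_of_computable {A B : Set ℕ} {h : ℕ → ℕ} (hh : Computable h)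
    (hAB : ∀ n, n ∈ A ↔ h n ∈ B) : TuringReducible (charFun A) (charFun B) := by
  classical
  obtain ⟨Φ, hΦ⟩ := hh.exists_oracleCode
  rw [turingReducible_iff_exists_oracleCode]
  refine ⟨.comp .oracle Φ, funext fun n => OracleCode.eval_comp_of_eq (hΦ _ n) ?_⟩
  simp [OracleCode.eval, charFun, Set.indicator_apply, hAB]

end Oracle

/-! ### Genericity and category -/

section Topology

/-- A given rational zero requires only finitely many primes to be in `W`, which is an open
condition. -/
theorem isOpen_solvableSet (L : List (ℤ × List ℕ)) : IsOpen (solvableSet (polyOfTerms L)) := by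
  have h : solvableSet (polyOfTerms L) = ⋃ y ∈ {y : ℕ → ℚ | evalTerms y L = 0},
      ⋂ i ∈ {i | i ∈ varsTerms L}, ⋂ p ∈ {p : Nat.Primes | (p : ℕ) ∣ (y i).den},
        {W : PrimeSets | W p = true} := by
    ext W
    simp only [solvableSet, Set.mem_ofPred_eq, polyOfTerms_mem_HTP_ringOf_iff, Set.mem_iUnion,
      Set.mem_iInter, exists_prop]
  rw [h]
  refine isOpen_biUnion fun y _ => (List.finite_toSet _).isOpen_biInter fun i _ =>
    Set.Finite.isOpen_biInter ?_ fun p _ => ?_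
  · refine Set.Finite.of_finite_image (f := fun p : Nat.Primes => (p : ℕ)) ?_
      Subtype.val_injective.injOn
    refine (Nat.divisors (y i).den).finite_toSet.subset ?_
    rintro _ ⟨p, hp, rfl⟩
    exact Nat.mem_divisors.2 ⟨hp, (y i).den_ne_zero⟩
  · have : IsOpen ((fun W : PrimeSets => W p) ⁻¹' {true}) :=
      (isOpen_discrete _).preimage (continuous_apply p)
    exact this

theorem IsOpen.isNowhereDense_frontier {X : Type*} [TopologicalSpace X] {s : Set X}
    (hs : IsOpen s) : IsNowhereDense (frontier s) := by
  rw [isClosed_frontier.isNowhereDense_iff, ← frontier_compl, interior_frontier hs.isClosed_compl]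

theorem setOf_isHTPGeneric_mem_residual {ν : ℕ ≃ MvPolynomial ℕ ℤ} (hν : IsComputableNumbering ν) :
    {W : PrimeSets | IsHTPGeneric W} ∈ residual PrimeSets := by
  obtain ⟨r, -, hr⟩ := hν
  have hmeagre : IsMeagre (⋃ f : MvPolynomial ℕ ℤ, frontier (solvableSet f)) := by
    have : Countable (MvPolynomial ℕ ℤ) := ν.symm.injective.countable
    refine isMeagre_iUnion fun f => IsNowhereDense.isMeagre (IsOpen.isNowhereDense_frontier ?_)
    rw [← ν.apply_symm_apply f, hr]
    exact isOpen_solvableSet _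
  exact hmeagre

/-- If `f = 0` has no solution in `R_W`, where `W` is HTP-generic, then this is due to finitely many
primes outside of `W`. -/
theorem IsHTPGeneric.exists_finset {W : PrimeSets} (hW : IsHTPGeneric W) {f : MvPolynomial ℕ ℤ}
    (hf : f ∉ HTP (ringOf W)) : ∃ F : Finset Nat.Primes, (∀ p ∈ F, W p = false) ∧
      f ∉ HTP (ringOf fun p => decide (p ∉ F)) := by
  classical
  -- A point of the closure outside `solvableSet f` would lie on the boundary, which genericity
  -- excludes.
  have hcl : W ∈ (closure (solvableSet f))ᶜ := by
    intro hc
    refine hW (Set.mem_iUnion.2 ⟨f, hc, fun hi => ?_⟩)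
    have : W ∈ solvableSet f := interior_subset hi
    exact hf this
  obtain ⟨F, u, hu, hFu⟩ := isOpen_pi_iff.1 isClosed_closure.isOpen_compl W hcl
  -- The set of all primes outside the filtered `F` agrees with `W` on `F`, so it lies in the same
  -- basic neighbourhood. It is the largest set there, hence the strongest test.
  refine ⟨F.filter fun p => W p = false, fun p hp => (Finset.mem_filter.1 hp).2, fun hV => ?_⟩
  have hmem : (fun p => decide (p ∉ F.filter fun p => W p = false)) ∈ (F : Set Nat.Primes).pi u := by
    intro p hp
    have : decide (p ∉ F.filter fun p => W p = false) = W p := by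
      have hp' : p ∈ F := hp
      cases hWp : W p <;> simp [hp', hWp]
    change decide (p ∉ F.filter fun p => W p = false) ∈ u p
    rw [this]
    exact (hu p hp).2
  exact hFu hmem (subset_closure hV)

end Topology

/-! ### Witnesses, the decision procedure and the two reductions -/

section Decision

/-- A witness for the solvability (`true`) or unsolvability (`false`) of a polynomial in `R_W`:
a list of tuples `(i, p, b)`, where `p` is the `i`-th prime and `b` a parameter for `p`, and the
numerators of a solution. -/
abbrev SolvabilityWitness : Type := Bool × List (ℕ × ℕ × ℕ) × List ℤ

/-- The polynomial whose rational solvability is asserted or refuted by a witness. -/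
def queryTerms (L : List (ℤ × List ℕ)) (w : SolvabilityWitness) : List (ℤ × List ℕ) :=
  bif w.1 then pointTerms L (w.2.1.map fun e => e.2.1).prod w.2.2
  else integralTerms L (w.2.1.map fun e => e.2)

/-- The test for a witness, where `q` is the index of the polynomial of the witness and `s` is an
initial segment of the oracle. -/
def IsAccepted (q : ℕ) (w : SolvabilityWitness) (s : List ℕ) : Prop :=
  (∀ e ∈ w.2.1, IsCertificateParam e.2.1 e.2.2 ∧ Nat.count Nat.Prime e.2.1 = e.1 ∧
    s[2 * e.1]? = some w.1.toNat) ∧ s[2 * q + 1]? = some w.1.toNat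

open Primrec in
theorem primrec₂_queryTerms : Primrec₂ queryTerms := by
  have h1 : Primrec fun a : List (ℤ × List ℕ) × SolvabilityWitness =>
      (a.2.2.1.map fun e => e.2.1).prod :=
    list_prod_nat (list_map (fst.comp (snd.comp snd)) (fst.comp (snd.comp snd)).to₂)
  have h2 : Primrec fun a : List (ℤ × List ℕ) × SolvabilityWitness => a.2.2.1.map fun e => e.2 :=
    list_map (fst.comp (snd.comp snd)) (snd.comp snd).to₂
  exact Primrec.cond (fst.comp snd)
    (primrec_pointTerms.comp (Primrec.pair fst (Primrec.pair h1 (snd.comp (snd.comp snd)))))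
    (primrec₂_integralTerms.comp fst h2)

open Primrec in
theorem primrecPred_isAccepted : PrimrecPred fun a : ℕ × SolvabilityWitness × List ℕ =>
    IsAccepted a.1 a.2.1 a.2.2 := by
  have hnat : Primrec Bool.toNat := dom_bool _
  have hrel : PrimrecRel fun (e : ℕ × ℕ × ℕ) (a : ℕ × SolvabilityWitness × List ℕ) =>
      IsCertificateParam e.2.1 e.2.2 ∧ Nat.count Nat.Prime e.2.1 = e.1 ∧
        a.2.2[2 * e.1]? = some a.2.1.1.toNat :=
    (primrecRel_isCertificateParam.comp (fst.comp (snd.comp fst)) (snd.comp (snd.comp fst))).and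
      ((Primrec.eq.comp (primrec_count_prime.comp (fst.comp (snd.comp fst))) (fst.comp fst)).and
        (Primrec.eq.comp (list_getElem?.comp (snd.comp (snd.comp snd))
          (nat_double.comp (fst.comp fst)))
          (option_some.comp (hnat.comp (fst.comp (fst.comp (snd.comp snd)))))))
  exact (hrel.forall_mem_list.comp (fst.comp (snd.comp (fst.comp snd))) .id).and
    (Primrec.eq.comp (list_getElem?.comp (snd.comp snd) (nat_double_succ.comp fst))
      (option_some.comp (hnat.comp (fst.comp (fst.comp snd)))))

theorem two_mul_mem_setJoin_iff {A B : Set ℕ} {n : ℕ} : 2 * n ∈ setJoin A B ↔ n ∈ A := by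
  simp only [setJoin, Set.mem_union, Set.mem_image]
  constructor
  · rintro (⟨m, hm, h⟩ | ⟨m, -, h⟩)
    · rwa [← Nat.eq_of_mul_eq_mul_left two_pos h]
    · omega
  · exact fun h => Or.inl ⟨n, h, rfl⟩

theorem two_mul_add_one_mem_setJoin_iff {A B : Set ℕ} {n : ℕ} :
    2 * n + 1 ∈ setJoin A B ↔ n ∈ B := by
  simp only [setJoin, Set.mem_union, Set.mem_image]
  constructor
  · rintro (⟨m, -, h⟩ | ⟨m, hm, h⟩)
    · omega
    · have : m = n := by omega
      rwa [← this]
  · exact fun h => Or.inr ⟨n, h, rfl⟩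

theorem mem_primeIndices_iff {W : PrimeSets} {i p : ℕ} (hp : p.Prime)
    (hi : Nat.count Nat.Prime p = i) : i ∈ primeIndices W ↔ W ⟨p, hp⟩ = true := by
  subst hi
  simp [primeIndices, Nat.nth_count hp]

theorem getElem?_map_range_eq_some_iff {g : ℕ → ℕ} {N j v : ℕ} :
    ((List.range N).map g)[j]? = some v ↔ j < N ∧ g j = v := by
  by_cases h : j < N
  · simp [h]
  · simp [h]

variable {ν : ℕ ≃ MvPolynomial ℕ ℤ} {W : PrimeSets}

theorem indicator_one_eq_toNat_iff {A : Set ℕ} {n : ℕ} {c : Bool} :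
    A.indicator (1 : ℕ → ℕ) n = c.toNat ↔ (n ∈ A ↔ c = true) := by
  classical
  rw [Set.indicator_apply]
  cases c <;> by_cases h : n ∈ A <;> simp [h]

/-- Separates the demand that the segment be long enough from the truth of its entries: even places
of the oracle describe `W`, odd places `HTP(ℚ)`. -/
theorem isAccepted_iff {q : ℕ} {w : SolvabilityWitness} {N : ℕ} :
    IsAccepted q w ((List.range N).map
      ((setJoin (primeIndices W) (HTPIndices ν ℚ)).indicator (1 : ℕ → ℕ))) ↔
    (∀ e ∈ w.2.1, 2 * e.1 < N) ∧ 2 * q + 1 < N ∧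
    (∀ e ∈ w.2.1, IsCertificateParam e.2.1 e.2.2 ∧ Nat.count Nat.Prime e.2.1 = e.1 ∧
      ∀ hp : e.2.1.Prime, W ⟨e.2.1, hp⟩ = w.1) ∧ (ν q ∈ HTP ℚ ↔ w.1 = true) := by
  simp only [IsAccepted, getElem?_map_range_eq_some_iff, indicator_one_eq_toNat_iff,
    two_mul_mem_setJoin_iff, two_mul_add_one_mem_setJoin_iff]
  constructor
  · rintro ⟨h1, h2, h3⟩
    refine ⟨fun e he => (h1 e he).2.2.1, h2, fun e he => ⟨(h1 e he).1, (h1 e he).2.1, fun hp => ?_⟩, h3⟩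
    have := (h1 e he).2.2.2
    rw [mem_primeIndices_iff hp (h1 e he).2.1] at this
    exact Bool.eq_iff_iff.2 this
  · rintro ⟨h1, h2, h3, h4⟩
    refine ⟨fun e he => ⟨(h3 e he).1, (h3 e he).2.1, h1 e he, ?_⟩, h2, h4⟩
    rw [mem_primeIndices_iff (h3 e he).1.1 (h3 e he).2.1, (h3 e he).2.2 (h3 e he).1.1]

/-- Soundness, for arbitrary `W`. In the positive case the denominators divide a product of primes
of `W`. In the negative case a solution in `R_W` would be integral at the listed primes, since these
lie outside `W`. -/
theorem mem_HTP_ringOf_iff_of_queryTerms {L : List (ℤ × List ℕ)} {w : SolvabilityWitness}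
    (hw : ∀ e ∈ w.2.1, IsCertificateParam e.2.1 e.2.2 ∧ ∀ hp : e.2.1.Prime, W ⟨e.2.1, hp⟩ = w.1)
    (hq : polyOfTerms (queryTerms L w) ∈ HTP ℚ ↔ w.1 = true) :
    polyOfTerms L ∈ HTP (ringOf W) ↔ w.1 = true := by
  obtain ⟨c, I, a⟩ := w
  rw [polyOfTerms_mem_HTP_ringOf_iff]
  rw [polyOfTerms_mem_HTP_iff] at hq
  cases c with
  | true =>
    simp only [queryTerms, cond_true, evalTerms_pointTerms_eq_zero_iff, iff_true] at hq hw ⊢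
    obtain ⟨x, hx, hxa⟩ := hq
    refine ⟨x, hx, fun i hi p hp => ?_⟩
    set m := (I.map fun e => e.2.1).prod with hm
    have hm0 : m ≠ 0 := by
      rw [hm, ne_eq, List.prod_eq_zero_iff, List.mem_map]
      rintro ⟨e, he, he0⟩
      exact (hw e he).1.1.ne_zero he0
    have hden : (x i).den ∣ m := by
      have h1 : x i = (a.getD i 0 : ℤ) / ((m : ℤ) : ℚ) := by
        rw [← hxa i hi]; push_cast
        field_simp
      rw [h1]
      rw [← Rat.divInt_eq_div]
      exact Int.natCast_dvd_natCast.1 (Rat.den_dvd (a.getD i 0) (m : ℤ))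
    obtain ⟨k, hk, hpk⟩ := (Nat.Prime.prime p.2).dvd_prod_iff.1 (hp.trans hden)
    obtain ⟨e, he, rfl⟩ := List.mem_map.1 hk
    have hpe := (Nat.prime_dvd_prime_iff_eq p.2 (hw e he).1.1).1 hpk
    have := (hw e he).2 (hpe ▸ p.2)
    rw [← this]
    congr 1
    exact Subtype.ext hpe
  | false =>
    simp only [queryTerms, cond_false, Bool.false_eq_true, iff_false] at hq hw ⊢
    rw [exists_evalTerms_integralTerms_iff _ (by
      simp only [List.forall_mem_map]; exact fun e he => (hw e he).1)] at hq
    rintro ⟨y, hy, hyW⟩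
    refine hq ⟨y, hy, fun i hi q hqI hdvd => ?_⟩
    obtain ⟨e, he, rfl⟩ := List.mem_map.1 hqI
    have h1 := hyW i hi ⟨e.2.1, (hw e he).1.1⟩ hdvd
    rw [(hw e he).2] at h1
    exact absurd h1 (by simp)

/-- An entry of a witness for the prime `p`. -/
noncomputable def witnessEntry (p : ℕ) (hp : p.Prime) : ℕ × ℕ × ℕ :=
  (Nat.count Nat.Prime p, p, (exists_isCertificateParam hp).choose)

theorem exists_witness_of_mem {L : List (ℤ × List ℕ)} (h : polyOfTerms L ∈ HTP (ringOf W)) :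
    ∃ w : SolvabilityWitness, (∀ e ∈ w.2.1, IsCertificateParam e.2.1 e.2.2 ∧
      Nat.count Nat.Prime e.2.1 = e.1 ∧ ∀ hp : e.2.1.Prime, W ⟨e.2.1, hp⟩ = w.1) ∧
      (polyOfTerms (queryTerms L w) ∈ HTP ℚ ↔ w.1 = true) := by
  obtain ⟨y, hy, hyW⟩ := (polyOfTerms_mem_HTP_ringOf_iff W L).1 h
  set m : ℕ := ((varsTerms L).map fun i => (y i).den).prod with hm
  have hm0 : m ≠ 0 := by
    rw [hm, ne_eq, List.prod_eq_zero_iff]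
    simp
  have hz : ∀ i, ∃ z : ℤ, i ∈ varsTerms L → (m : ℚ) * y i = z := by
    intro i
    by_cases hi : i ∈ varsTerms L
    · obtain ⟨k, hk⟩ := List.dvd_prod (List.mem_map_of_mem (f := fun i => (y i).den) hi)
      refine ⟨(y i).num * k, fun _ => ?_⟩
      rw [hm, hk]; push_cast; rw [← Rat.mul_den_eq_num (y i)]; ring
    · exact ⟨0, fun h => absurd h hi⟩
  choose z hz using hz
  -- Prime factors are listed with multiplicity, so that their product is `m` itself.
  let I := m.primeFactorsList.pmap witnessEntry fun p hp => Nat.prime_of_mem_primeFactorsList hp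
  -- Every variable index in `L` is at most the sum of all of them, so this list of numerators is
  -- long enough.
  refine ⟨(true, I, (List.range ((varsTerms L).sum + 1)).map z), ?_, ?_⟩
  · intro e he
    obtain ⟨p, hp, rfl⟩ := List.mem_pmap.1 he
    have hpp := Nat.prime_of_mem_primeFactorsList hp
    refine ⟨(exists_isCertificateParam hpp).choose_spec, rfl, fun _ => ?_⟩
    obtain ⟨k, hk, hpk⟩ := hpp.prime.dvd_prod_iff.1 (Nat.dvd_of_mem_primeFactorsList hp)
    obtain ⟨i, hi, rfl⟩ := List.mem_map.1 hk
    exact hyW i hi ⟨p, hpp⟩ hpk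
  · simp only [iff_true, queryTerms, cond_true]
    rw [polyOfTerms_mem_HTP_iff]
    have hI : (I.map fun e => e.2.1) = m.primeFactorsList := by
      simp [I, List.map_pmap, witnessEntry]
    refine ⟨y, ?_⟩
    rw [hI, Nat.prod_primeFactorsList hm0, evalTerms_pointTerms_eq_zero_iff]
    refine ⟨hy, fun i hi => ?_⟩
    have hlt : i < (varsTerms L).sum + 1 := Nat.lt_succ_of_le (List.le_sum_of_mem hi)
    rw [hz i hi]
    simp [List.getD_eq_getElem?_getD, hlt]

/-- The only place where the algorithm needs genericity: the finite obstruction is the witness. -/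
theorem exists_witness_of_notMem {L : List (ℤ × List ℕ)} (hW : IsHTPGeneric W)
    (h : polyOfTerms L ∉ HTP (ringOf W)) :
    ∃ w : SolvabilityWitness, (∀ e ∈ w.2.1, IsCertificateParam e.2.1 e.2.2 ∧
      Nat.count Nat.Prime e.2.1 = e.1 ∧ ∀ hp : e.2.1.Prime, W ⟨e.2.1, hp⟩ = w.1) ∧
      (polyOfTerms (queryTerms L w) ∈ HTP ℚ ↔ w.1 = true) := by
  obtain ⟨F, hF, hV⟩ := hW.exists_finset h
  let I : List (ℕ × ℕ × ℕ) := F.toList.map fun p : Nat.Primes => witnessEntry p.1 p.2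
  have hI : ∀ e ∈ I, IsCertificateParam e.2.1 e.2.2 := by
    intro e he
    obtain ⟨p, hp, rfl⟩ := List.mem_map.1 he
    exact (exists_isCertificateParam p.2).choose_spec
  refine ⟨(false, I, []), ?_, ?_⟩
  · intro e he
    refine ⟨hI e he, ?_⟩
    obtain ⟨p, hp, rfl⟩ := List.mem_map.1 he
    exact ⟨rfl, fun _ => hF p (Finset.mem_toList.1 hp)⟩
  · simp only [queryTerms, cond_false, Bool.false_eq_true, iff_false]
    rw [polyOfTerms_mem_HTP_iff, exists_evalTerms_integralTerms_iff _ (by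
      simp only [List.forall_mem_map]; exact hI)]
    rintro ⟨y, hy, hyI⟩
    refine hV ((polyOfTerms_mem_HTP_ringOf_iff _ L).2 ⟨y, hy, fun i hi p hp => ?_⟩)
    rw [decide_eq_true_iff]
    intro hpF
    refine hyI i hi (witnessEntry p p.2).2 (List.mem_map_of_mem (List.mem_map_of_mem
      (Finset.mem_toList.2 hpF))) hp

open Classical in
theorem computable_isAccepted (hν : IsComputableNumbering ν) {r : ℕ → List (ℤ × List ℕ)}
    (hr : Computable r) : Computable fun a : ℕ × SolvabilityWitness × List ℕ =>
      decide (IsAccepted (ν.symm (polyOfTerms (queryTerms (r a.1) a.2.1))) a.2.1 a.2.2) := by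
  have h1 : Computable fun a : ℕ × SolvabilityWitness × List ℕ => r a.1 :=
    hr.comp Computable.fst
  have h2 : Computable fun a : ℕ × SolvabilityWitness × List ℕ => a.2.1 :=
    Computable.fst.comp Computable.snd
  have h3 : Computable fun a : ℕ × SolvabilityWitness × List ℕ => queryTerms (r a.1) a.2.1 :=
    Computable₂.comp primrec₂_queryTerms.to_comp h1 h2
  have h4 : Computable fun a : ℕ × SolvabilityWitness × List ℕ =>
      ν.symm (polyOfTerms (queryTerms (r a.1) a.2.1)) :=
    hν.computable_symm.comp h3
  have h5 : Computable fun a : ℕ × SolvabilityWitness × List ℕ =>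
      (ν.symm (polyOfTerms (queryTerms (r a.1) a.2.1)), a.2) := h4.pair Computable.snd
  have h6 : Computable fun a : ℕ × SolvabilityWitness × List ℕ =>
      decide (IsAccepted a.1 a.2.1 a.2.2) := primrecPred_isAccepted.decide.to_comp
  have h7 := h6.comp h5
  exact h7

theorem exists_isAccepted (hW : IsHTPGeneric W) (L : List (ℤ × List ℕ)) :
    ∃ (w : SolvabilityWitness) (N : ℕ),
      IsAccepted (ν.symm (polyOfTerms (queryTerms L w))) w ((List.range N).map
        ((setJoin (primeIndices W) (HTPIndices ν ℚ)).indicator (1 : ℕ → ℕ))) := by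
  obtain ⟨w, hw, hq⟩ : ∃ w : SolvabilityWitness, (∀ e ∈ w.2.1, IsCertificateParam e.2.1 e.2.2 ∧
      Nat.count Nat.Prime e.2.1 = e.1 ∧ ∀ hp : e.2.1.Prime, W ⟨e.2.1, hp⟩ = w.1) ∧
      (polyOfTerms (queryTerms L w) ∈ HTP ℚ ↔ w.1 = true) := by
    by_cases h : polyOfTerms L ∈ HTP (ringOf W)
    · exact exists_witness_of_mem h
    · exact exists_witness_of_notMem hW h
  refine ⟨w, (w.2.1.map fun e => 2 * e.1).sum +
    2 * ν.symm (polyOfTerms (queryTerms L w)) + 2, isAccepted_iff.2 ⟨fun e he => ?_, by omega, hw, ?_⟩⟩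
  · have := List.le_sum_of_mem (List.mem_map_of_mem (f := fun e : ℕ × ℕ × ℕ => 2 * e.1) he)
    omega
  · rw [Equiv.apply_symm_apply]
    exact hq

theorem IsAccepted.mem_HTP_ringOf_iff {L : List (ℤ × List ℕ)} {w : SolvabilityWitness} {N : ℕ}
    (h : IsAccepted (ν.symm (polyOfTerms (queryTerms L w))) w ((List.range N).map
      ((setJoin (primeIndices W) (HTPIndices ν ℚ)).indicator (1 : ℕ → ℕ)))) :
    polyOfTerms L ∈ HTP (ringOf W) ↔ w.1 = true := by
  have hw := isAccepted_iff.1 h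
  rw [Equiv.apply_symm_apply] at hw
  exact mem_HTP_ringOf_iff_of_queryTerms
    (fun e he => ⟨(hw.2.2.1 e he).1, (hw.2.2.1 e he).2.2⟩) hw.2.2.2

/-- The test depends on `W` only through the oracle segment, so one program serves all `W`.
Genericity makes it halt, and soundness makes its output correct. -/
theorem exists_oracleCode_HTP (hν : IsComputableNumbering ν) : ∃ Φ : OracleCode, ∀ W : PrimeSets,
    IsHTPGeneric W → Φ.eval (charFun (setJoin (primeIndices W) (HTPIndices ν ℚ))) =
      charFun (HTPIndices ν (ringOf W)) := by
  classical
  obtain ⟨r, hr, hνr⟩ := id hν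
  have hout : Computable fun w : SolvabilityWitness => w.1.toNat :=
    ((Primrec.dom_bool Bool.toNat).comp Primrec.fst).to_comp
  obtain ⟨Φ, hΦ⟩ := exists_oracleCode_search (computable_isAccepted hν hr) hout
  refine ⟨Φ, fun W hW => funext fun n => ?_⟩
  refine hΦ _ ((setJoin (primeIndices W) (HTPIndices ν ℚ)).indicator 1) (fun _ => rfl) n
    ((HTPIndices ν (ringOf W)).indicator 1 n) ?_ ?_
  · obtain ⟨w, N, h⟩ := exists_isAccepted (ν := ν) hW (r n)
    exact ⟨w, N, decide_eq_true h⟩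
  · intro w N hw
    have := (of_decide_eq_true hw).mem_HTP_ringOf_iff
    rw [← hνr] at this
    exact (indicator_one_eq_toNat_iff.2 this).symm

/-- A many-one reduction: the number `2k` is sent to `p_k X - 1`, solvable exactly when `p_k` is
inverted, and `2k + 1` to the homogenized form of the polynomial with index `k`. -/
theorem turingReducible_setJoin_HTPIndices (hν : IsComputableNumbering ν) (W : PrimeSets) :
    TuringReducible (charFun (setJoin (primeIndices W) (HTPIndices ν ℚ)))
      (charFun (HTPIndices ν (ringOf W))) := by
  have hidx := hν.computable_symm
  obtain ⟨r, hr, hνr⟩ := hν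
  have hlin : Primrec fun p : ℕ => [((p : ℤ), [0]), ((-1 : ℤ), ([] : List ℕ))] :=
    Primrec.list_cons.comp (Primrec.pair Primrec.int_natCast (Primrec.const _)) (Primrec.const _)
  have hterms : Computable fun n : ℕ => bif n.bodd then rationalTerms (r n.div2)
      else [((Nat.nth Nat.Prime n.div2 : ℕ), [0]), ((-1 : ℤ), ([] : List ℕ))] :=
    Computable.cond Computable.nat_bodd (primrec_rationalTerms.to_comp.comp
      (hr.comp Computable.nat_div2)) (hlin.to_comp.comp
        (computable_nth_prime.comp Computable.nat_div2))
  refine turingReducible_charFun_of_computable (hidx.comp hterms) fun n => ?_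
  simp only [HTPIndices, Set.mem_ofPred_eq, Equiv.apply_symm_apply]
  rcases Nat.even_or_odd' n with ⟨k, rfl | rfl⟩
  · have h1 : (2 * k).bodd = false := by simp
    have h2 : (2 * k).div2 = k := by simp [Nat.div2_val]
    have hp := Nat.prime_nth_prime k
    rw [two_mul_mem_setJoin_iff, h1, cond_false, h2, polyOfTerms_mem_HTP_iff,
      exists_evalTerms_subring_iff]
    simp only [primeIndices, Set.mem_ofPred_eq, evalTerms_cons, evalTerms_nil, List.map_cons,
      List.map_nil, List.prod_cons, List.prod_nil, varsTerms, List.flatMap_cons, List.flatMap_nil,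
      List.mem_append, List.mem_singleton, List.not_mem_nil, or_false, forall_eq]
    push_cast
    have hp0 : (Nat.nth Nat.Prime k : ℚ) ≠ 0 := by exact_mod_cast hp.ne_zero
    constructor
    · intro hW
      refine ⟨fun _ => 1 / (Nat.nth Nat.Prime k : ℚ), by field_simp; norm_num, ?_⟩
      exact Subring.subset_closure ⟨⟨_, hp⟩, hW, rfl⟩
    · rintro ⟨y, hy, hyW⟩
      have hy0 : y 0 = (Nat.nth Nat.Prime k : ℚ)⁻¹ := by
        field_simp; linarith
      refine mem_ringOf_iff.1 hyW ⟨_, hp⟩ ?_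
      rw [hy0, Rat.inv_natCast_den_of_pos hp.pos]
  · have h1 : (2 * k + 1).bodd = true := by simp
    have h2 : (2 * k + 1).div2 = k := by simp [Nat.div2_val]
    rw [two_mul_add_one_mem_setJoin_iff, h1, cond_true, h2, polyOfTerms_mem_HTP_iff,
      exists_evalTerms_rationalTerms_iff]
    simp only [Set.mem_ofPred_eq, hνr, polyOfTerms_mem_HTP_iff]

end Decision

theorem proposition3p2 (ν : ℕ ≃ MvPolynomial ℕ ℤ) (hν : IsComputableNumbering ν) :
    (∃ Φ : OracleCode,
      {W : PrimeSets |
        Φ.eval (charFun (setJoin (primeIndices W) (HTPIndices ν ℚ))) =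
          charFun (HTPIndices ν (ringOf W))} ∈ residual PrimeSets) ∧
    ∀ W : PrimeSets, IsHTPGeneric W →
      TuringEquivalent (charFun (HTPIndices ν (ringOf W)))
        (charFun (setJoin (primeIndices W) (HTPIndices ν ℚ))) := by
  obtain ⟨Φ, hΦ⟩ := exists_oracleCode_HTP hν
  exact ⟨⟨Φ, Filter.mem_of_superset (setOf_isHTPGeneric_mem_residual hν) hΦ⟩, fun W hW =>
    ⟨turingReducible_iff_exists_oracleCode.2 ⟨Φ, hΦ W hW⟩, turingReducible_setJoin_HTPIndices hν W⟩⟩
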